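/- Let $p\ge 0$ be an integer, let $\mathbf a=(a_1,\dots,a_{p+1})\in\mathbb C^{p+1}$ with $\operatorname{Re}(a_i)>0$ for all $i$, and let $\mathbf b=(b_1,\dots,b_p)\in\mathbb C^p$ with no $b_j$ in $\{0,-1,-2,\dots\}$. For a vector $\mathbf c=(c_1,\dots,c_r)$ write $(\mathbf c)_n=\prod_i c_i(c_i+1)\cdots(c_i+n-1)$, $\mathbf c+\mu=(c_1+\mu,\dots,c_r+\mu)$, and $\Delta(\mathbf c,k)=(\mathbf c/k,(\mathbf c+1)/k,\dots,(\mathbf c+k-1)/k)$. For $q\ge 0$, ${}_{q+1}F_q(\mathbf u;\mathbf v;w)$ denotes the analytic continuation to $\mathbb C\setminus[1,\infty)$ of $\sum_{n\ge 0}\frac{(\mathbf u)_n}{(\mathbf v)_n\,n!}w^n$, $|w|<1$. For $m\in\{1,2,4,5\}$ and $y>0$ put $$\psi_m(y)=\frac{y^{m+2}(\mathbf a)_m}{(3)_m(\mathbf b)_m}\;{}_{3p+4}F_{3p+3}\bigl(3,\Delta(\mathbf a+m,3);\,\Delta(\mathbf b+m,3),\Delta(m+3,3);\,y^3\bigr),$$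 where for $y^3=t\ge 1$ the value $F(t)$ of the hypergeometric function on the cut is taken, by the same convention for all $m$, to be either $F(t+i0)=\lim_{\varepsilon\to0+}F(t+i\varepsilon)$, or $F(t-i0)=\lim_{\varepsilon\to0+}F(t-i\varepsilon)$, or the average $\tfrac12\bigl(F(t+i0)+F(t-i0)\bigr)$. The limits exist for every $t>1$ (at the single point $t=1$ they may fail to exist). For each of the three conventions and for every $z\neq0$ with $|\arg z|<\pi/3$, the integral below converges absolutely and $${}_{p+1}F_p(\mathbf a;\mathbf b;-z)=\frac{9\sqrt3}{2\pi}\int_0^\infty\frac{\psi_1(y)-2\psi_2(y)+2\psi_4(y)-\psi_5(y)}{z^3+y^3}\,dy .$$ If, moreover, all $a_i$ and $b_j$ are real, then for each of the three conventions the numerator $\psi_1(y)-2\psi_2(y)+2\psi_4(y)-\psi_5(y)$ is real for every $y>0$, $y\ne1$, and also at $y=1$ if the limits above exist there for each of the four functions. -/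

import Mathlib

open Filter Topology MeasureTheory

noncomputable section

namespace GenHyp

/-- `(c)_n = (c_1)_n (c_2)_n ⋯ (c_r)_n`, the product of the rising factorials of the components
of a finite parameter vector `c` (the order of the components plays no role). -/
def poch (c : Multiset ℂ) (n : ℕ) : ℂ :=
  (c.map fun x => (ascPochhammer ℂ n).eval x).prod

/-- The `n`-th coefficient `(a)_n / ((b)_n n!)` of the generalized hypergeometric series. -/
def coeff (a b : Multiset ℂ) (n : ℕ) : ℂ :=
  poch a n / (poch b n * (n.factorial : ℂ))

/-- The cut plane `ℂ ∖ [1, ∞)`. -/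
def cutPlane : Set ℂ := {w | w.re < 1 ∨ w.im ≠ 0}

/-- `f` is an analytic continuation to `ℂ ∖ [1, ∞)` of the sum, in the open unit disc, of the
generalized hypergeometric series with upper parameters `a` and lower parameters `b`. -/
def IsContinuation (a b : Multiset ℂ) (f : ℂ → ℂ) : Prop :=
  AnalyticOnNhd ℂ f cutPlane ∧
    ∀ w : ℂ, ‖w‖ < 1 → HasSum (fun n : ℕ => coeff a b n * w ^ n) (f w)

open Classical in
/-- The generalized hypergeometric function `_{p+1}F_p(a; b; w)` (`a` has one component more than
`b`) on the cut plane `ℂ ∖ [1, ∞)`: the analytic continuation of the sum of the series. On the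
cut plane it does not depend on the choice made here, by the identity theorem; the values of this
function on the cut `[1, ∞)` carry no meaning and are not used. -/
def hyp (a b : Multiset ℂ) (w : ℂ) : ℂ :=
  if h : ∃ f : ℂ → ℂ, IsContinuation a b f then h.choose w else 0

/-- `L` is the boundary value `F(t + i0)`, the limit of `F(t + iε)` as `ε → 0+`. -/
def IsAbove (a b : Multiset ℂ) (t : ℝ) (L : ℂ) : Prop :=
  Tendsto (fun ε : ℝ => hyp a b ((t : ℂ) + (ε : ℂ) * Complex.I)) (𝓝[>] 0) (𝓝 L)

/-- `L` is the boundary value `F(t - i0)`, the limit of `F(t - iε)` as `ε → 0+`. -/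
def IsBelow (a b : Multiset ℂ) (t : ℝ) (L : ℂ) : Prop :=
  Tendsto (fun ε : ℝ => hyp a b ((t : ℂ) - (ε : ℂ) * Complex.I)) (𝓝[>] 0) (𝓝 L)

/-- The two boundary values `F(t ± i0)` exist as finite limits. -/
def HasBoundaryValues (a b : Multiset ℂ) (t : ℝ) : Prop :=
  (∃ L, IsAbove a b t L) ∧ ∃ L, IsBelow a b t L

/-- The boundary value `F(t + i0)`. -/
def hypAbove (a b : Multiset ℂ) (t : ℝ) : ℂ :=
  limUnder (𝓝[>] (0 : ℝ)) fun ε : ℝ => hyp a b ((t : ℂ) + (ε : ℂ) * Complex.I)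

/-- The boundary value `F(t - i0)`. -/
def hypBelow (a b : Multiset ℂ) (t : ℝ) : ℂ :=
  limUnder (𝓝[>] (0 : ℝ)) fun ε : ℝ => hyp a b ((t : ℂ) - (ε : ℂ) * Complex.I)

/-- The three conventions for the values on the branch cut. -/
inductive Side where
  | above : Side
  | below : Side
  | mean : Side

/-- The value `F(t)` for real `t`: the function itself for `t < 1`, and on the cut `t ≥ 1` the
value `F(t + i0)`, the value `F(t - i0)`, or the average `(F(t + i0) + F(t - i0)) / 2`. -/
def hypOn (s : Side) (a b : Multiset ℂ) (t : ℝ) : ℂ :=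
  if t < 1 then hyp a b (t : ℂ)
  else
    match s with
    | Side.above => hypAbove a b t
    | Side.below => hypBelow a b t
    | Side.mean => (hypAbove a b t + hypBelow a b t) / 2

/-- `c + μ = (c_1 + μ, …, c_r + μ)`. -/
def shift (c : Multiset ℂ) (μ : ℂ) : Multiset ℂ := c.map fun x => x + μ

/-- `Δ(c, k) = (c/k, (c+1)/k, …, (c+k-1)/k)`, a vector with `k` times as many components. -/
def delta (c : Multiset ℂ) (k : ℕ) : Multiset ℂ :=
  c.bind fun x => (Multiset.range k).map fun j => (x + (j : ℂ)) / (k : ℂ)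

/-- The upper parameters `3, Δ(a + m, 3)` of the function in `ψ_m`. -/
def psiUpper (a : Multiset ℂ) (m : ℕ) : Multiset ℂ := {3} + delta (shift a m) 3

/-- The lower parameters `Δ(b + m, 3), Δ(m + 3, 3)` of the function in `ψ_m`. -/
def psiLower (b : Multiset ℂ) (m : ℕ) : Multiset ℂ := delta (shift b m) 3 + delta {(m : ℂ) + 3} 3

/-- `ψ_m(y) = y^{m+2} (a)_m / ((3)_m (b)_m) F(3, Δ(a+m,3); Δ(b+m,3), Δ(m+3,3); y³)`, with the
convention `s` for the values of `F` on the cut. -/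
def psi (s : Side) (a b : Multiset ℂ) (m : ℕ) (y : ℝ) : ℂ :=
  (y : ℂ) ^ (m + 2) * poch a m / (poch {3} m * poch b m) *
    hypOn s (psiUpper a m) (psiLower b m) (y ^ 3)

/-- The numerator `ψ_1 - 2ψ_2 + 2ψ_4 - ψ_5`. -/
def numerator (s : Side) (a b : Multiset ℂ) (y : ℝ) : ℂ :=
  psi s a b 1 y - 2 * psi s a b 2 y + 2 * psi s a b 4 y - psi s a b 5 y

end GenHyp

end

/-! Let f be the continued function and let ω be the primitive cube root of unity. The series of ψ_m
is y² Σ_k (k+1)(k+2) c_n y^n / ((n+1)(n+2)) with n = m + 3k, where c_n are the coefficients of f. In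
ψ_1 - 2ψ_2 + 2ψ_4 - ψ_5 all weights collapse to ±1/3: the coefficient of y^{n+2} is c_n/3 for n ≡ 1,
-c_n/3 for n ≡ 2 and 0 for n ≡ 0 mod 3. Hence the numerator equals y² (f(ωy) - f(ω²y)) / (3 i √3),
which is `jump`. This holds in the unit disc, then by the identity theorem in the sector |arg y| <
π/3 off the real axis, and by a limit on the positive axis from either side. The closed form does
not see the cut, so the three conventions agree. For real parameters, f(ω²y) is the conjugate of
f(ωy), which makes the numerator real.

The integral formula is then Cauchy's formula for f at -z on the sector |arg(-w)| < π/3, whose edges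
are the rays through ω and ω². In the coordinate w = -e^x the sector is the strip |Im x| < π/3. The
kernel 3e^{3x}/(e^{3x} - z³) has a single pole there, at x = log z, and takes the same values on
both edges, where e^{3x} = -y³. Decay f(w) = O(|w|^{-δ}) for Re w ≤ 0 gives absolute convergence and
controls the vertical edges (`integral_jump_div`).

Continuation, decay and boundary values come from iterated Euler integrals. Multiplying coefficients
by (a)_n/(b)_n is, up to a constant, a multiplicative convolution with a Beta kernel
(`SpiralContinuable.mul_pochhammer_div`). A polynomial factor absorbs the case where Re b is too
small, and the starting series are sums of powers (1 - w)^{-k-1}. Running each integral along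
t^{1+αi} in place of t gives a continuation to the complement of a logarithmic spiral from 1. For
small α of the right sign the spiral bends away from the side of approach, so f extends
holomorphically past a given t > 1 from that side and the one-sided limit exists
(`exists_tendsto_hyp`). -/

noncomputable section

namespace GenHyp

/-! ### Planes cut along logarithmic spirals -/

/-- The complement of the logarithmic spiral `{exp ((1 + α i) σ) | σ ≥ 0}`. -/
def spiralPlane (α : ℝ) : Set ℂ :=
  {w | ‖w‖ < 1 ∨ w ≠ Complex.exp ((1 + α * Complex.I) * (Real.log ‖w‖ : ℝ))}

theorem isOpen_spiralPlane (α : ℝ) : IsOpen (spiralPlane α) := by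
  rw [isOpen_iff_mem_nhds]
  intro w hw
  rcases hw with hw | hw
  · exact Filter.mem_of_superset ((isOpen_lt continuous_norm continuous_const).mem_nhds hw)
      fun x hx => Or.inl hx
  · by_cases h0 : w = 0
    · subst h0
      exact Filter.mem_of_superset ((isOpen_lt continuous_norm continuous_const).mem_nhds
        (show ‖(0 : ℂ)‖ < 1 by simp)) fun x hx => Or.inl hx
    have hc : ContinuousAt (fun w : ℂ =>
        Complex.exp ((1 + α * Complex.I) * (Real.log ‖w‖ : ℝ))) w := by
      have h1 : ContinuousAt (fun w : ℂ => Real.log ‖w‖) w :=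
        continuous_norm.continuousAt.log (norm_ne_zero_iff.2 h0)
      have h2 : ContinuousAt (fun w : ℂ => ((Real.log ‖w‖ : ℝ) : ℂ)) w :=
        Complex.continuous_ofReal.continuousAt.comp h1
      exact (continuousAt_const.mul h2).cexp
    filter_upwards [ContinuousAt.eventually_ne (g := fun x : ℂ => x - Complex.exp
      ((1 + α * Complex.I) * (Real.log ‖x‖ : ℝ))) (continuousAt_id.sub hc) (sub_ne_zero.2 hw)] with x hx
    exact Or.inr (sub_ne_zero.1 hx)

theorem mem_spiralPlane_of_norm_lt {α : ℝ} {w : ℂ} (h : ‖w‖ < 1) : w ∈ spiralPlane α := Or.inl h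

theorem spiralPlane_zero : spiralPlane 0 = cutPlane := by
  ext w
  simp only [spiralPlane, cutPlane, Set.mem_ofPred_eq]
  by_cases h0 : w = 0
  · subst h0; simp
  have hn : 0 < ‖w‖ := norm_pos_iff.2 h0
  have he : Complex.exp ((1 + ((0 : ℝ) : ℂ) * Complex.I) * (Real.log ‖w‖ : ℝ)) = (‖w‖ : ℂ) := by
    rw [Complex.ofReal_zero, zero_mul, add_zero, one_mul, ← Complex.ofReal_exp, Real.exp_log hn]
  rw [he]
  constructor
  · rintro (h | h)
    · exact Or.inl (lt_of_le_of_lt (Complex.re_le_norm w) h)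
    · by_contra! hc
      apply h
      have : w = (w.re : ℂ) := Complex.ext (by simp) (by simp [hc.2])
      rw [this, Complex.norm_real, Real.norm_of_nonneg (by linarith)]
  · rintro h
    by_contra! hc
    have h1 : w.re = ‖w‖ := by rw [hc.2]; simp
    have h2 : w.im = 0 := by rw [hc.2]; simp
    rcases h with h | h
    · linarith [hc.1]
    · exact h h2

theorem isOpen_cutPlane : IsOpen cutPlane := spiralPlane_zero ▸ isOpen_spiralPlane 0

/-- Multiplication by t^{1+αi} moves w inwards along its own logarithmic spiral. If the image lay on
the spiral through 1, cancelling the common factor would put w on it too. This starlikeness lets an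
integral over t ∈ (0,1) stay in the domain. -/
theorem mul_cpow_mem_spiralPlane {α : ℝ} {w : ℂ} (hw : w ∈ spiralPlane α) {t : ℝ} (h0 : 0 ≤ t)
    (h1 : t ≤ 1) : w * (t : ℂ) ^ (1 + α * Complex.I) ∈ spiralPlane α := by
  have hτ : (1 + α * Complex.I) ≠ 0 := by
    intro h
    simpa using congrArg Complex.re h
  rcases h0.eq_or_lt with rfl | h0
  · left
    simp [Complex.zero_cpow hτ]
  have hn : ‖(t : ℂ) ^ (1 + α * Complex.I)‖ = t := by
    rw [Complex.norm_cpow_eq_rpow_re_of_pos h0]; simp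
  rcases hw with hw | hw
  · left
    rw [norm_mul, hn]
    nlinarith [norm_nonneg w]
  · by_cases hw0 : w = 0
    · left; simp [hw0]
    have hwn : 0 < ‖w‖ := norm_pos_iff.2 hw0
    right
    intro h
    apply hw
    rw [norm_mul, hn, Real.log_mul hwn.ne' h0.ne', Complex.ofReal_add, mul_add, Complex.exp_add,
      Complex.cpow_def_of_ne_zero (by exact_mod_cast h0.ne'), Complex.ofReal_log h0.le,
      mul_comm (Complex.log _)] at h
    exact mul_right_cancel₀ (Complex.exp_ne_zero _) h

/-! ### Multiplicative convolutions over (0, 1) -/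

section Transform

variable {U : Set ℂ} {F : ℂ → ℂ} {φ k : ℝ → ℂ}

theorem bounded_comp_mul (hU : IsOpen U) (hF : ContinuousOn F U) (hφ : Continuous φ)
    (hinv : ∀ w ∈ U, ∀ t ∈ Set.Icc (0 : ℝ) 1, w * φ t ∈ U) {w₀ : ℂ} (hw₀ : w₀ ∈ U) :
    ∃ ε > 0, Metric.closedBall w₀ ε ⊆ U ∧ ∃ M, ∀ w ∈ Metric.closedBall w₀ ε,
      ∀ t ∈ Set.Icc (0 : ℝ) 1, ‖F (w * φ t)‖ ≤ M := by
  obtain ⟨ε, hε, hsub⟩ := Metric.nhds_basis_closedBall.mem_iff.1 (hU.mem_nhds hw₀)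
  refine ⟨ε, hε, hsub, ?_⟩
  have hK : IsCompact (Metric.closedBall w₀ ε ×ˢ Set.Icc (0 : ℝ) 1) :=
    (isCompact_closedBall _ _).prod isCompact_Icc
  have hc : ContinuousOn (fun p : ℂ × ℝ => F (p.1 * φ p.2))
      (Metric.closedBall w₀ ε ×ˢ Set.Icc (0 : ℝ) 1) :=
    hF.comp (continuous_fst.mul (hφ.comp continuous_snd)).continuousOn
      fun p hp => hinv _ (hsub hp.1) _ hp.2
  obtain ⟨M, hM⟩ := hK.exists_bound_of_continuousOn hc
  exact ⟨M, fun w hw t ht => hM (w, t) ⟨hw, ht⟩⟩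

theorem aestronglyMeasurable_comp_mul (hF : ContinuousOn F U) (hφ : Continuous φ)
    (hinv : ∀ w ∈ U, ∀ t ∈ Set.Icc (0 : ℝ) 1, w * φ t ∈ U) {w : ℂ} (hw : w ∈ U) :
    AEStronglyMeasurable (fun t => F (w * φ t)) (volume.restrict (Set.Ioo (0 : ℝ) 1)) :=
  (hF.comp (continuous_const.mul hφ).continuousOn fun t ht =>
    hinv w hw t (Set.Ioo_subset_Icc_self ht)).aestronglyMeasurable measurableSet_Ioo

theorem ae_restrict_Ioo {P : ℝ → Prop} (h : ∀ t ∈ Set.Ioo (0 : ℝ) 1, P t) :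
    ∀ᵐ t ∂(volume.restrict (Set.Ioo (0 : ℝ) 1)), P t :=
  (ae_restrict_iff' measurableSet_Ioo).2 (Eventually.of_forall h)

/-- A multiplicative convolution of a holomorphic function is holomorphic. -/
theorem differentiableOn_mulConv (hU : IsOpen U) (hF : DifferentiableOn ℂ F U) (hφ : Continuous φ)
    (hinv : ∀ w ∈ U, ∀ t ∈ Set.Icc (0 : ℝ) 1, w * φ t ∈ U)
    (hk : IntegrableOn k (Set.Ioo 0 1)) :
    DifferentiableOn ℂ (fun w => ∫ t in Set.Ioo (0 : ℝ) 1, k t * F (w * φ t)) U := by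
  intro w₀ hw₀
  have hF' : ContinuousOn (deriv F) U := (hF.deriv hU).continuousOn
  obtain ⟨ε, hε, hsub, M, hM⟩ := bounded_comp_mul hU hF' hφ hinv hw₀
  obtain ⟨ε₀, hε₀, -, M₀, hM₀⟩ := bounded_comp_mul hU hF.continuousOn hφ hinv hw₀
  obtain ⟨B, hB⟩ := (isCompact_Icc (a := (0 : ℝ)) (b := 1)).exists_bound_of_continuousOn
    hφ.continuousOn
  have hB0 : 0 ≤ B := (norm_nonneg _).trans (hB 0 (by simp))
  have hM0 : 0 ≤ M := (norm_nonneg _).trans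
    (hM w₀ (Metric.mem_closedBall_self hε.le) 0 (by simp))
  have hnhds : Metric.closedBall w₀ ε ∈ 𝓝 w₀ := Metric.closedBall_mem_nhds _ hε
  have hd := hasDerivAt_integral_of_dominated_loc_of_deriv_le (𝕜 := ℂ)
    (μ := volume.restrict (Set.Ioo (0 : ℝ) 1)) (F := fun w t => k t * F (w * φ t))
    (F' := fun w t => k t * (deriv F (w * φ t) * φ t)) (x₀ := w₀)
    (bound := fun t => ‖k t‖ * (M * B)) hnhds ?_ ?_ ?_ ?_ ?_ ?_
  · exact hd.2.differentiableAt.differentiableWithinAt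
  · filter_upwards [hnhds] with w hw
    exact hk.aestronglyMeasurable.mul (aestronglyMeasurable_comp_mul hF.continuousOn hφ hinv
      (hsub hw))
  · exact hk.mul_bdd (c := M₀) (aestronglyMeasurable_comp_mul hF.continuousOn hφ hinv hw₀)
      (ae_restrict_Ioo fun t ht => hM₀ w₀ (Metric.mem_closedBall_self hε₀.le) t
        (Set.Ioo_subset_Icc_self ht))
  · exact hk.aestronglyMeasurable.mul ((aestronglyMeasurable_comp_mul hF' hφ hinv hw₀).mul
      hφ.aestronglyMeasurable)
  · refine ae_restrict_Ioo fun t ht w hw => ?_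
    have ht' := Set.Ioo_subset_Icc_self ht
    rw [norm_mul, norm_mul]
    gcongr
    · exact hM w hw t ht'
    · exact hB t ht'
  · exact hk.norm.mul_const _
  · refine ae_restrict_Ioo fun t ht w hw => ?_
    have hmem := hinv w (hsub hw) t (Set.Ioo_subset_Icc_self ht)
    have h1 : HasDerivAt F (deriv F (w * φ t)) (w * φ t) :=
      (hF.differentiableAt (hU.mem_nhds hmem)).hasDerivAt
    have h2 : HasDerivAt (fun w : ℂ => w * φ t) (φ t) w := by
      simpa using (hasDerivAt_id w).mul_const (φ t)
    exact (h1.comp w h2).const_mul (k t)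

theorem hasSum_mulConv {c : ℕ → ℂ} (hF : ∀ w : ℂ, ‖w‖ < 1 → HasSum (fun n => c n * w ^ n) (F w))
    (hφ : Continuous φ) (hφ1 : ∀ t ∈ Set.Ioo (0 : ℝ) 1, ‖φ t‖ ≤ 1)
    (hk : IntegrableOn k (Set.Ioo 0 1)) {w : ℂ} (hw : ‖w‖ < 1) :
    HasSum (fun n => c n * (∫ t in Set.Ioo (0 : ℝ) 1, k t * φ t ^ n) * w ^ n)
      (∫ t in Set.Ioo (0 : ℝ) 1, k t * F (w * φ t)) := by
  have hs : Summable fun n => ‖c n * w ^ n‖ := (hF w hw).summable.norm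
  have := hasSum_integral_of_dominated_convergence
    (μ := volume.restrict (Set.Ioo (0 : ℝ) 1))
    (F := fun n t => k t * (c n * (w * φ t) ^ n)) (f := fun t => k t * F (w * φ t))
    (fun n t => ‖k t‖ * ‖c n * w ^ n‖) ?_ ?_ ?_ ?_ ?_
  · have h : ∀ n, c n * (∫ t in Set.Ioo (0 : ℝ) 1, k t * φ t ^ n) * w ^ n =
        ∫ t in Set.Ioo (0 : ℝ) 1, k t * (c n * (w * φ t) ^ n) := by
      intro n
      rw [mul_right_comm, ← integral_const_mul]
      congr 1 with t
      ring
    simpa only [h] using this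
  · intro n
    exact hk.aestronglyMeasurable.mul (by fun_prop)
  · intro n
    refine ae_restrict_Ioo fun t ht => ?_
    rw [norm_mul, mul_pow, ← mul_assoc, norm_mul (c n * w ^ n)]
    gcongr
    rw [norm_pow]
    exact mul_le_of_le_one_right (norm_nonneg _) (pow_le_one₀ (norm_nonneg _) (hφ1 t ht))
  · exact Eventually.of_forall fun t => hs.mul_left _
  · simp_rw [tsum_mul_left]
    exact hk.norm.mul_const _
  · refine ae_restrict_Ioo fun t ht => ?_
    refine (hF _ ?_).mul_left _
    rw [norm_mul]
    exact lt_of_le_of_lt (mul_le_of_le_one_right (norm_nonneg _) (hφ1 t ht)) hw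

/-- The bound is homogeneous, |wt|^{-δ} = |w|^{-δ} t^{-δ}, and the left half-plane is stable under
scaling by t > 0. Power decay therefore survives whenever t^{-δ} is integrable against the kernel.
Only the untilted case is needed. -/
theorem norm_mulConv_le {δ C : ℝ}
    (hF : ∀ w : ℂ, w.re ≤ 0 → w ≠ 0 → ‖F w‖ ≤ C * ‖w‖ ^ (-δ))
    (hk : IntegrableOn (fun t : ℝ => ‖k t‖ * t ^ (-δ)) (Set.Ioo 0 1)) {w : ℂ} (hw : w.re ≤ 0)
    (hw0 : w ≠ 0) :
    ‖∫ t in Set.Ioo (0 : ℝ) 1, k t * F (w * t)‖ ≤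
      (C * ∫ t in Set.Ioo (0 : ℝ) 1, ‖k t‖ * t ^ (-δ)) * ‖w‖ ^ (-δ) := by
  have h : (C * ∫ t in Set.Ioo (0 : ℝ) 1, ‖k t‖ * t ^ (-δ)) * ‖w‖ ^ (-δ) =
      ∫ t in Set.Ioo (0 : ℝ) 1, (C * ‖w‖ ^ (-δ)) * (‖k t‖ * t ^ (-δ)) := by
    rw [integral_const_mul]; ring
  rw [h]
  refine norm_integral_le_of_norm_le (hk.const_mul _) (ae_restrict_Ioo fun t ht => ?_)
  have h1 := hF (w * t) (by simpa using mul_nonpos_of_nonpos_of_nonneg hw ht.1.le)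
    (mul_ne_zero hw0 (by exact_mod_cast ht.1.ne'))
  rw [norm_mul w, Complex.norm_real, Real.norm_of_nonneg ht.1.le,
    Real.mul_rpow (norm_nonneg _) ht.1.le] at h1
  rw [norm_mul]
  calc ‖k t‖ * ‖F (w * t)‖ ≤ ‖k t‖ * (C * (‖w‖ ^ (-δ) * t ^ (-δ))) := by gcongr
    _ = _ := by ring

end Transform

/-! ### Tilted Beta integrals -/

/-- The exponent `1 + α i`. -/
def tilt (α : ℝ) : ℂ := 1 + α * Complex.I

@[simp] theorem tilt_re (α : ℝ) : (tilt α).re = 1 := by simp [tilt]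

@[simp] theorem tilt_im (α : ℝ) : (tilt α).im = α := by simp [tilt]

@[simp] theorem tilt_zero : tilt 0 = 1 := by simp [tilt]

theorem tilt_ne_zero (α : ℝ) : tilt α ≠ 0 := fun h => by simpa using congrArg Complex.re h

theorem continuous_tilt : Continuous tilt := by unfold tilt; fun_prop

theorem norm_cpow_tilt (α : ℝ) {t : ℝ} (ht : 0 < t) : ‖(t : ℂ) ^ tilt α‖ = t := by
  rw [Complex.norm_cpow_eq_rpow_re_of_pos ht]; simp

theorem continuous_cpow_tilt (α : ℝ) : Continuous fun t : ℝ => (t : ℂ) ^ tilt α :=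
  Complex.continuous_ofReal_cpow_const (by simp)

theorem one_sub_cpow_mem_slitPlane (α : ℝ) {t : ℝ} (ht : t ∈ Set.Ioo (0 : ℝ) 1) :
    1 - (t : ℂ) ^ tilt α ∈ Complex.slitPlane := by
  left
  have := Complex.re_le_norm ((t : ℂ) ^ tilt α)
  rw [norm_cpow_tilt α ht.1] at this
  simp only [Complex.sub_re, Complex.one_re]
  linarith [ht.2]

/-- The tilted Beta kernel `t^{τ a - 1} (1 - t^τ)^{c - 1}`, `τ = 1 + α i`. -/
def betaKernel (a c : ℂ) (α : ℝ) (t : ℝ) : ℂ :=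
  (t : ℂ) ^ (tilt α * a - 1) * (1 - (t : ℂ) ^ tilt α) ^ (c - 1)

theorem continuousOn_betaKernel (a c : ℂ) (α : ℝ) :
    ContinuousOn (betaKernel a c α) (Set.Ioo 0 1) := by
  refine ContinuousOn.mul ?_ ?_
  · exact (Complex.continuous_ofReal.continuousOn).cpow_const fun t ht => Or.inl (by simpa using ht.1)
  · exact (continuous_const.sub (continuous_cpow_tilt α)).continuousOn.cpow_const
      fun t ht => one_sub_cpow_mem_slitPlane α ht

/-- With Re c ≥ 1 there is no singularity at t = 1. The constant comes from |1 - t^τ| ≤ 2 and from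
|arg| ≤ π, which controls the imaginary part of the exponent. -/
theorem norm_betaKernel_le (a : ℂ) {c : ℂ} (hc : 1 ≤ c.re) (α : ℝ) {t : ℝ}
    (ht : t ∈ Set.Ioo (0 : ℝ) 1) :
    ‖betaKernel a c α t‖ ≤
      t ^ ((tilt α * a).re - 1) * (2 ^ (c.re - 1) * Real.exp (Real.pi * |c.im|)) := by
  rw [betaKernel, norm_mul, Complex.norm_cpow_eq_rpow_re_of_pos ht.1, Complex.sub_re,
    Complex.one_re]
  have h1 := Complex.norm_cpow_le (1 - (t : ℂ) ^ tilt α) (c - 1)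
  refine mul_le_mul_of_nonneg_left (h1.trans ?_) (Real.rpow_nonneg ht.1.le _)
  rw [div_eq_mul_inv, ← Real.exp_neg]
  simp only [Complex.sub_re, Complex.one_re, Complex.sub_im, Complex.one_im, sub_zero]
  have h2 : ‖1 - (t : ℂ) ^ tilt α‖ ≤ 2 := by
    refine (norm_sub_le _ _).trans ?_
    rw [norm_cpow_tilt α ht.1, norm_one]
    linarith [ht.2]
  have h3 : -((1 - (t : ℂ) ^ tilt α).arg * c.im) ≤ Real.pi * |c.im| := by
    refine (neg_le_abs _).trans ?_
    rw [abs_mul]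
    exact mul_le_mul_of_nonneg_right (Complex.abs_arg_le_pi _) (abs_nonneg _)
  exact mul_le_mul (Real.rpow_le_rpow (norm_nonneg _) h2 (by linarith)) (Real.exp_le_exp.2 h3)
    (Real.exp_nonneg _) (by positivity)

theorem integrableOn_rpow_Ioo {r : ℝ} (hr : -1 < r) :
    IntegrableOn (fun t : ℝ => t ^ r) (Set.Ioo 0 1) :=
  (intervalIntegrable_iff_integrableOn_Ioo_of_le zero_le_one).1
    (intervalIntegral.intervalIntegrable_rpow' hr)

theorem integrableOn_betaKernel {a c : ℂ} (hc : 1 ≤ c.re) {α : ℝ} (ha : 0 < (tilt α * a).re) :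
    IntegrableOn (betaKernel a c α) (Set.Ioo 0 1) :=
  Integrable.mono' ((integrableOn_rpow_Ioo (r := (tilt α * a).re - 1) (by linarith)).mul_const _)
    ((continuousOn_betaKernel a c α).aestronglyMeasurable measurableSet_Ioo)
    (ae_restrict_Ioo fun _ ht => norm_betaKernel_le a hc α ht)

/-- The moments of the tilted Beta kernel. -/
def betaMoment (a c : ℂ) (α : ℝ) (n : ℕ) : ℂ :=
  ∫ t in Set.Ioo (0 : ℝ) 1, betaKernel a c α t * ((t : ℂ) ^ tilt α) ^ n

theorem betaKernel_mul_pow (a c : ℂ) (α : ℝ) {t : ℝ} (ht : 0 < t) (n : ℕ) :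
    betaKernel a c α t * ((t : ℂ) ^ tilt α) ^ n = betaKernel (a + n) c α t := by
  have ht' : (t : ℂ) ≠ 0 := by exact_mod_cast ht.ne'
  rw [betaKernel, betaKernel, mul_right_comm, ← Complex.cpow_nat_mul, ← Complex.cpow_add _ _ ht']
  ring_nf

theorem betaMoment_eq (a c : ℂ) (α : ℝ) (n : ℕ) :
    betaMoment a c α n = ∫ t in Set.Ioo (0 : ℝ) 1, betaKernel (a + n) c α t :=
  setIntegral_congr_fun measurableSet_Ioo fun _ ht => betaKernel_mul_pow a c α ht.1 n

/-- The derivative of t^{τa}(1 - t^τ)^c integrates to 0 over (0,1), since the function vanishes at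
both ends. This yields the Beta recurrence directly for the tilted kernel, with no deformation of
the path. -/
theorem betaIntegral_succ {a c : ℂ} (hc : 1 ≤ c.re) {α : ℝ} (ha : 0 < (tilt α * a).re) :
    (a + c) * ∫ t in Set.Ioo (0 : ℝ) 1, betaKernel (a + 1) c α t =
      a * ∫ t in Set.Ioo (0 : ℝ) 1, betaKernel a c α t := by
  have hτ := tilt_ne_zero α
  have ha0 : tilt α * a ≠ 0 := fun h => by simp [h] at ha
  have ha1 : 0 < (tilt α * (a + 1)).re := by rw [mul_add, mul_one]; simp [-Complex.mul_re]; linarith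
  have hc0 : c ≠ 0 := fun h => by simp [h] at hc; linarith
  have i0 := integrableOn_betaKernel hc ha
  have i1 := integrableOn_betaKernel hc ha1
  have hder : ∀ t ∈ Set.Ioo (0 : ℝ) 1,
      HasDerivAt (fun t : ℝ => (t : ℂ) ^ (tilt α * a) * (1 - (t : ℂ) ^ tilt α) ^ c)
        (tilt α * (a * betaKernel a c α t - (a + c) * betaKernel (a + 1) c α t)) t := by
    intro t ht
    have ht' : (t : ℂ) ≠ 0 := by exact_mod_cast ht.1.ne'
    have hs := one_sub_cpow_mem_slitPlane α ht
    have d1 := hasDerivAt_ofReal_cpow_const ht.1.ne' ha0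
    have d2 : HasDerivAt (fun t : ℝ => 1 - (t : ℂ) ^ tilt α)
        (-(tilt α * (t : ℂ) ^ (tilt α - 1))) t :=
      (hasDerivAt_ofReal_cpow_const ht.1.ne' hτ).const_sub 1
    have d3 := (((hasDerivAt_id _).cpow_const (c := c) hs)).comp t d2
    have d4 := d1.mul d3
    refine d4.congr_deriv ?_
    have e1 : (1 - (t : ℂ) ^ tilt α) ^ c =
        (1 - (t : ℂ) ^ tilt α) ^ (c - 1) * (1 - (t : ℂ) ^ tilt α) := by
      rw [Complex.cpow_sub _ _ (Complex.slitPlane_ne_zero hs), Complex.cpow_one,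
        div_mul_cancel₀ _ (Complex.slitPlane_ne_zero hs)]
    have e2 : (t : ℂ) ^ (tilt α * (a + 1) - 1) =
        (t : ℂ) ^ (tilt α * a - 1) * (t : ℂ) ^ tilt α := by
      rw [← Complex.cpow_add _ _ ht']; ring_nf
    have e3 : (t : ℂ) ^ (tilt α * a) * (t : ℂ) ^ (tilt α - 1) =
        (t : ℂ) ^ (tilt α * a - 1) * (t : ℂ) ^ tilt α := by
      rw [← Complex.cpow_add _ _ ht', ← Complex.cpow_add _ _ ht']; ring_nf
    simp only [betaKernel, e2, Function.comp, id, e1]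
    linear_combination (-(c * tilt α * (1 - (t : ℂ) ^ tilt α) ^ (c - 1))) * e3
  have hcont : ContinuousOn (fun t : ℝ => (t : ℂ) ^ (tilt α * a) * (1 - (t : ℂ) ^ tilt α) ^ c)
      (Set.Icc 0 1) := by
    refine (Complex.continuous_ofReal_cpow_const ha).continuousOn.mul ?_
    intro t ht
    have hu : ContinuousAt (fun t : ℝ => 1 - (t : ℂ) ^ tilt α) t :=
      (continuous_const.sub (continuous_cpow_tilt α)).continuousAt
    refine (ContinuousAt.comp (g := fun z : ℂ => z ^ c) ?_ hu).continuousWithinAt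
    rcases ht.1.eq_or_lt with rfl | h0
    · refine continuousAt_cpow_const ?_
      simp [Complex.zero_cpow hτ]
    · rcases ht.2.eq_or_lt with rfl | h1
      -- At t = 1 the base is 0, off the slit plane; continuity of the power there uses Re c > 0.
      · simp only [Complex.ofReal_one, Complex.one_cpow, sub_self]
        exact Complex.continuousAt_cpow_zero_of_re_pos (z := c) (by linarith) |>.comp
          (f := fun z : ℂ => (z, c)) (by fun_prop)
      · exact continuousAt_cpow_const (one_sub_cpow_mem_slitPlane α ⟨h0, h1⟩)
  have hint : IntegrableOn (fun t => tilt α * (a * betaKernel a c α t -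
      (a + c) * betaKernel (a + 1) c α t)) (Set.Ioo 0 1) :=
    ((i0.const_mul a).sub (i1.const_mul (a + c))).const_mul _
  have key := intervalIntegral.integral_eq_sub_of_hasDerivAt_of_le zero_le_one hcont hder
    ((intervalIntegrable_iff_integrableOn_Ioo_of_le zero_le_one).2 hint)
  rw [intervalIntegral.integral_of_le zero_le_one, integral_Ioc_eq_integral_Ioo,
    integral_const_mul, integral_sub (i0.const_mul a) (i1.const_mul (a + c)),
    integral_const_mul, integral_const_mul] at key
  simp only [Complex.ofReal_one, Complex.ofReal_zero, Complex.one_cpow, sub_self,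
    Complex.zero_cpow hc0, Complex.zero_cpow ha0, zero_mul, mul_zero, mul_eq_zero, hτ,
    false_or] at key
  linear_combination -key

theorem ascPochhammer_eval_ne_zero {x : ℂ} (hx : ∀ n : ℕ, x ≠ -(n : ℂ)) (n : ℕ) :
    (ascPochhammer ℂ n).eval x ≠ 0 := by
  induction n with
  | zero => simp
  | succ n ih =>
    rw [ascPochhammer_succ_eval]
    exact mul_ne_zero ih fun h => hx n (eq_neg_of_add_eq_zero_left h)

theorem ne_neg_natCast_of_re_pos {x : ℂ} (hx : 0 < x.re) (n : ℕ) : x ≠ -(n : ℂ) := by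
  rintro rfl
  simp at hx
  linarith [(Nat.cast_nonneg n : (0 : ℝ) ≤ n)]

theorem betaMoment_eq_pochhammer {a c : ℂ} (ha0 : 0 < a.re) (hc : 1 ≤ c.re) {α : ℝ}
    (ha : 0 < (tilt α * a).re) (n : ℕ) :
    betaMoment a c α n = betaMoment a c α 0 *
      ((ascPochhammer ℂ n).eval a / (ascPochhammer ℂ n).eval (a + c)) := by
  have hne : ∀ m : ℕ, a + c ≠ -(m : ℂ) := ne_neg_natCast_of_re_pos (by
    rw [Complex.add_re]; linarith)
  induction n with
  | zero => simp
  | succ n ih =>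
    have h := betaIntegral_succ (a := a + n) hc (α := α) (by
      rw [mul_add, Complex.add_re]
      have : 0 ≤ (tilt α * (n : ℂ)).re := by simp
      linarith)
    have h1 : a + c + n ≠ 0 := fun h => hne n (eq_neg_of_add_eq_zero_left h)
    rw [add_assoc a (n : ℂ) 1, show ((n : ℂ) + 1) = ((n + 1 : ℕ) : ℂ) by push_cast; rfl, ← betaMoment_eq,
      ← betaMoment_eq, ih] at h
    rw [ascPochhammer_succ_eval, ascPochhammer_succ_eval]
    have h2 := ascPochhammer_eval_ne_zero hne n
    field_simp at h ⊢
    linear_combination h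

/-- At α = 0 this is Euler's Beta integral, a quotient of nonzero Gamma values, and the integral is
continuous in α. Its exact value for α ≠ 0 is never needed, because it is only divided out. -/
theorem betaMoment_zero_ne_zero {a c : ℂ} (ha : 0 < a.re) (hc : 1 ≤ c.re) :
    ∀ᶠ α in 𝓝 (0 : ℝ), betaMoment a c α 0 ≠ 0 := by
  have h0 : betaMoment a c 0 0 ≠ 0 := by
    have : betaMoment a c 0 0 = Complex.betaIntegral a c := by
      rw [Complex.betaIntegral, intervalIntegral.integral_of_le zero_le_one,
        integral_Ioc_eq_integral_Ioo]
      simp [betaMoment, betaKernel]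
    rw [this]
    intro h
    have := Complex.Gamma_mul_Gamma_eq_betaIntegral ha (t := c) (by linarith)
    rw [h, mul_zero] at this
    exact mul_ne_zero (Complex.Gamma_ne_zero_of_re_pos ha)
      (Complex.Gamma_ne_zero_of_re_pos (by linarith)) this
  have hre : ContinuousAt (fun α : ℝ => (tilt α * a).re) 0 :=
    (Complex.continuous_re.comp (continuous_tilt.mul continuous_const)).continuousAt
  have hev : ∀ᶠ α in 𝓝 (0 : ℝ), a.re / 2 < (tilt α * a).re :=
    hre.eventually (lt_mem_nhds (by simp; linarith))
  -- Dominated convergence: near α = 0 the exponent satisfies Re(τa) > Re(a)/2, which gives a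
  -- majorant independent of α.
  refine ContinuousAt.eventually_ne ?_ h0
  refine continuousAt_of_dominated (bound := fun t => t ^ (a.re / 2 - 1) *
    (2 ^ (c.re - 1) * Real.exp (Real.pi * |c.im|))) ?_ ?_ ?_ ?_
  · refine Eventually.of_forall fun α => ?_
    exact (((continuousOn_betaKernel a c α).mul ((continuous_cpow_tilt α).pow 0).continuousOn)
      ).aestronglyMeasurable measurableSet_Ioo
  · filter_upwards [hev] with α hα
    refine ae_restrict_Ioo fun t ht => ?_
    rw [pow_zero, mul_one]
    refine (norm_betaKernel_le a hc α ht).trans ?_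
    refine mul_le_mul_of_nonneg_right ?_ (by positivity)
    exact Real.rpow_le_rpow_of_exponent_ge ht.1 ht.2.le (by linarith)
  · exact (integrableOn_rpow_Ioo (by linarith)).mul_const _
  · refine ae_restrict_Ioo fun t ht => ?_
    have ht' : (t : ℂ) ≠ 0 := by exact_mod_cast ht.1.ne'
    have hτ := continuous_tilt.continuousAt (x := 0)
    simp only [pow_zero, mul_one, betaKernel]
    refine ContinuousAt.mul ?_ ?_
    · exact ((hτ.mul continuousAt_const).sub continuousAt_const).const_cpow (Or.inl ht')
    · exact ContinuousAt.comp (g := fun z : ℂ => z ^ (c - 1))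
        (continuousAt_cpow_const (one_sub_cpow_mem_slitPlane 0 ht))
        (continuousAt_const.sub (hτ.const_cpow (Or.inl ht')))

/-! ### Continuation of the series by tilted Euler transforms -/

/-- The power series with coefficients `c` continues to the complement of every logarithmic spiral
close to `[1, ∞)`, and its continuation to the cut plane is `O(|w|^{-δ})` in the left half-plane. -/
def SpiralContinuable (δ : ℝ) (c : ℕ → ℂ) : Prop :=
  ∀ᶠ α in 𝓝 (0 : ℝ), ∃ F : ℂ → ℂ, DifferentiableOn ℂ F (spiralPlane α) ∧
    (∀ w : ℂ, ‖w‖ < 1 → HasSum (fun n => c n * w ^ n) (F w)) ∧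
    (α = 0 → ∃ C : ℝ, ∀ w : ℂ, w.re ≤ 0 → w ≠ 0 → ‖F w‖ ≤ C * ‖w‖ ^ (-δ))

theorem SpiralContinuable.add {δ : ℝ} {c d : ℕ → ℂ} (hc : SpiralContinuable δ c)
    (hd : SpiralContinuable δ d) : SpiralContinuable δ (c + d) := by
  filter_upwards [hc, hd] with α ⟨F, hF1, hF2, hF3⟩ ⟨G, hG1, hG2, hG3⟩
  refine ⟨fun w => F w + G w, hF1.add hG1, fun w hw => ?_, fun h => ?_⟩
  · simpa only [Pi.add_apply, add_mul] using (hF2 w hw).add (hG2 w hw)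
  · obtain ⟨C, hC⟩ := hF3 h
    obtain ⟨D, hD⟩ := hG3 h
    refine ⟨C + D, fun w hw hw0 => (norm_add_le _ _).trans ?_⟩
    rw [add_mul]
    exact add_le_add (hC w hw hw0) (hD w hw hw0)

theorem SpiralContinuable.smul {δ : ℝ} {c : ℕ → ℂ} (hc : SpiralContinuable δ c) (x : ℂ) :
    SpiralContinuable δ (x • c) := by
  filter_upwards [hc] with α ⟨F, hF1, hF2, hF3⟩
  refine ⟨fun w => x * F w, hF1.const_mul x, fun w hw => ?_, fun h => ?_⟩
  · simpa only [Pi.smul_apply, smul_eq_mul, mul_assoc] using (hF2 w hw).mul_left x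
  · obtain ⟨C, hC⟩ := hF3 h
    refine ⟨‖x‖ * C, fun w hw hw0 => ?_⟩
    rw [norm_mul, mul_assoc]
    exact mul_le_mul_of_nonneg_left (hC w hw hw0) (norm_nonneg _)

/-- The sequences `n ↦ q(n)`, `q` a polynomial, spanned by the binomial coefficients. -/
def binomSpan : Submodule ℂ (ℕ → ℂ) :=
  Submodule.span ℂ (Set.range fun k n : ℕ => ((n + k).choose k : ℂ))

theorem one_notMem_spiralPlane (α : ℝ) : (1 : ℂ) ∉ spiralPlane α := by
  simp [spiralPlane]

/-- The generating function of the k-th binomial sequence is (1 - w)^{-k-1}, singular only at 1, a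
point of every spiral. For Re w ≤ 0 one has |1 - w| ≥ max(1, |w|) ≥ |w|^δ; this is where δ ≤ 1
enters. -/
theorem spiralContinuable_of_mem_binomSpan {δ : ℝ} (h0 : 0 ≤ δ) (h1 : δ ≤ 1) {c : ℕ → ℂ}
    (hc : c ∈ binomSpan) : SpiralContinuable δ c := by
  induction hc using Submodule.span_induction with
  | zero =>
    refine Eventually.of_forall fun α => ⟨0, differentiableOn_const 0, fun w _ => ?_, fun _ =>
      ⟨0, fun w _ _ => by simp⟩⟩
    simp
  | add c d _ _ hc hd => exact hc.add hd
  | smul x c _ hc => exact hc.smul x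
  | mem c hc =>
    obtain ⟨k, rfl⟩ := hc
    refine Eventually.of_forall fun α => ⟨fun w => 1 / (1 - w) ^ (k + 1), ?_,
      fun w hw => hasSum_choose_mul_geometric_of_norm_lt_one k hw, fun _ => ⟨1, fun w hw hw0 => ?_⟩⟩
    · intro w hw
      have : (1 - w) ^ (k + 1) ≠ 0 := pow_ne_zero _ (sub_ne_zero.2 fun h =>
        one_notMem_spiralPlane α (h ▸ hw))
      exact (DifferentiableAt.fun_div (c := fun _ => (1 : ℂ)) (by fun_prop)
        (d := fun w : ℂ => (1 - w) ^ (k + 1)) (by fun_prop) this).differentiableWithinAt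
    · have hn : 0 < ‖w‖ := norm_pos_iff.2 hw0
      have g1 : 1 ≤ ‖1 - w‖ := by
        have := Complex.re_le_norm (1 - w)
        simp only [Complex.sub_re, Complex.one_re] at this
        linarith
      have g2 : ‖w‖ ≤ ‖1 - w‖ := by
        rw [← sq_le_sq₀ (norm_nonneg _) (norm_nonneg _), Complex.sq_norm, Complex.sq_norm,
          Complex.normSq_apply, Complex.normSq_apply]
        simp only [Complex.sub_re, Complex.one_re, Complex.sub_im, Complex.one_im]
        nlinarith
      rw [one_mul, norm_div, norm_one, norm_pow, Real.rpow_neg hn.le, ← one_div]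
      refine one_div_le_one_div_of_le (by positivity) ?_
      refine le_trans ?_ (le_self_pow₀ g1 (by omega))
      rcases le_total ‖w‖ 1 with h | h
      · exact (Real.rpow_le_one hn.le h h0).trans g1
      · exact (Real.rpow_le_rpow_of_exponent_le h h1).trans (by rwa [Real.rpow_one])

theorem add_mul_mem_binomSpan {c : ℕ → ℂ} (hc : c ∈ binomSpan) (b : ℂ) :
    (fun n : ℕ => (b + n) * c n) ∈ binomSpan := by
  induction hc using Submodule.span_induction with
  | zero =>
    convert binomSpan.zero_mem using 1
    ext n; simp
  | add c d _ _ hc hd =>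
    convert binomSpan.add_mem hc hd using 1
    ext n; simp [mul_add]
  | smul x c _ hc =>
    convert binomSpan.smul_mem x hc using 1
    ext n; simp; ring
  | mem c hc =>
    obtain ⟨k, rfl⟩ := hc
    have m1 : (fun n : ℕ => ((n + (k + 1)).choose (k + 1) : ℂ)) ∈ binomSpan :=
      Submodule.subset_span ⟨k + 1, rfl⟩
    have m0 : (fun n : ℕ => ((n + k).choose k : ℂ)) ∈ binomSpan :=
      Submodule.subset_span ⟨k, rfl⟩
    -- Write b + n = (n + k + 1) + (b - k - 1); the first summand raises k, by (n+k+1) C(n+k, k) =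
    -- (k+1) C(n+k+1, k+1).
    convert binomSpan.add_mem (binomSpan.smul_mem ((k : ℂ) + 1) m1)
      (binomSpan.smul_mem (b - k - 1) m0) using 1
    ext n
    have h := Nat.add_one_mul_choose_eq (n + k) k
    have h' : ((n : ℂ) + k + 1) * ((n + k).choose k : ℂ) =
        ((n + (k + 1)).choose (k + 1) : ℂ) * ((k : ℂ) + 1) := by
      rw [← add_assoc]; exact_mod_cast h
    simp only [Pi.add_apply, Pi.smul_apply, smul_eq_mul]
    linear_combination h'

theorem pochhammer_mul_mem_binomSpan {c : ℕ → ℂ} (hc : c ∈ binomSpan) (b : ℂ) (N : ℕ) :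
    (fun n : ℕ => (ascPochhammer ℂ N).eval (b + n) * c n) ∈ binomSpan := by
  induction N with
  | zero => simpa using hc
  | succ N ih =>
    convert add_mul_mem_binomSpan ih (b + N) using 1
    ext n
    rw [ascPochhammer_succ_eval]
    ring

theorem pochhammer_add (x : ℂ) (m n : ℕ) : (ascPochhammer ℂ (m + n)).eval x =
    (ascPochhammer ℂ m).eval x * (ascPochhammer ℂ n).eval (x + m) := by
  rw [← ascPochhammer_mul]
  simp

/-- Euler's transform: the normalized Beta kernel has moments (a)_n/(b)_n. The condition Re b ≥ Re a
+ 1 keeps it bounded near t = 1, and δ < Re a makes t^{Re a - 1 - δ} integrable, so the decay is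
inherited. -/
theorem SpiralContinuable.mul_pochhammer_div {δ : ℝ} {c : ℕ → ℂ} (hc : SpiralContinuable δ c)
    {a b : ℂ} (h0 : 0 < δ) (ha : δ < a.re) (hb : a.re + 1 ≤ b.re) :
    SpiralContinuable δ fun n =>
      c n * ((ascPochhammer ℂ n).eval a / (ascPochhammer ℂ n).eval b) := by
  obtain ⟨d, rfl⟩ : ∃ d, b = a + d := ⟨b - a, by ring⟩
  have hd : 1 ≤ d.re := by rw [Complex.add_re] at hb; linarith
  have hre : ContinuousAt (fun α : ℝ => (tilt α * a).re) 0 :=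
    (Complex.continuous_re.comp (continuous_tilt.mul continuous_const)).continuousAt
  have hev : ∀ᶠ α in 𝓝 (0 : ℝ), 0 < (tilt α * a).re :=
    hre.eventually (lt_mem_nhds (by simp; linarith))
  filter_upwards [hc, hev, betaMoment_zero_ne_zero (a := a) (by linarith) hd] with α ⟨F, hF1, hF2, hF3⟩ hα hβ
  set k : ℝ → ℂ := fun t => (betaMoment a d α 0)⁻¹ * betaKernel a d α t with hk
  have hki : IntegrableOn k (Set.Ioo 0 1) := (integrableOn_betaKernel hd hα).const_mul _
  have hφ := continuous_cpow_tilt α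
  refine ⟨fun w => ∫ t in Set.Ioo (0 : ℝ) 1, k t * F (w * (t : ℂ) ^ tilt α),
    differentiableOn_mulConv (isOpen_spiralPlane α) hF1 hφ
      (fun w hw t ht => mul_cpow_mem_spiralPlane hw ht.1 ht.2) hki, fun w hw => ?_, fun h => ?_⟩
  · have := hasSum_mulConv hF2 hφ
      (fun t ht => by rw [norm_cpow_tilt α ht.1]; exact ht.2.le) hki hw
    have hm : ∀ n, ∫ t in Set.Ioo (0 : ℝ) 1, k t * ((t : ℂ) ^ tilt α) ^ n =
        (ascPochhammer ℂ n).eval a / (ascPochhammer ℂ n).eval (a + d) := by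
      intro n
      simp_rw [hk, mul_assoc]
      rw [integral_const_mul, ← betaMoment, betaMoment_eq_pochhammer (by linarith) hd hα n,
        inv_mul_cancel_left₀ hβ]
    simpa only [hm] using this
  · subst h
    obtain ⟨C, hC⟩ := hF3 rfl
    refine ⟨C * ∫ t in Set.Ioo (0 : ℝ) 1, ‖k t‖ * t ^ (-δ), fun w hw hw0 => ?_⟩
    simp only [tilt_zero, Complex.cpow_one]
    refine norm_mulConv_le hC ?_ hw hw0
    refine Integrable.mono' ((integrableOn_rpow_Ioo (r := a.re - 1 - δ) (by linarith)).const_mul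
      (‖(betaMoment a d 0 0)⁻¹‖ * (2 ^ (d.re - 1) * Real.exp (Real.pi * |d.im|)))) ?_ ?_
    · refine hki.aestronglyMeasurable.norm.mul ?_
      exact (continuousOn_id.rpow_const fun t ht => Or.inl ht.1.ne').aestronglyMeasurable
        measurableSet_Ioo
    · refine ae_restrict_Ioo fun t ht => ?_
      have hb := norm_betaKernel_le a hd 0 ht
      rw [tilt_zero, one_mul] at hb
      rw [norm_mul, norm_norm, Real.norm_of_nonneg (Real.rpow_nonneg ht.1.le _), hk, norm_mul,
        sub_eq_add_neg (a.re - 1), Real.rpow_add ht.1]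
      have hp : 0 ≤ t ^ (-δ) := Real.rpow_nonneg ht.1.le _
      calc ‖(betaMoment a d 0 0)⁻¹‖ * ‖betaKernel a d 0 t‖ * t ^ (-δ) ≤
          ‖(betaMoment a d 0 0)⁻¹‖ * (t ^ (a.re - 1) * (2 ^ (d.re - 1) *
            Real.exp (Real.pi * |d.im|))) * t ^ (-δ) := by gcongr
        _ = _ := by ring

theorem poch_cons (x : ℂ) (c : Multiset ℂ) (n : ℕ) :
    poch (x ::ₘ c) n = (ascPochhammer ℂ n).eval x * poch c n := by
  simp [poch]

theorem poch_zero (n : ℕ) : poch 0 n = 1 := by simp [poch]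

/-- Upper and lower parameters are paired, one Euler transform per pair. The polynomial sequence q
is universally quantified because raising a lower parameter costs a polynomial factor, which the
induction hypothesis must absorb before the transform is applied. -/
theorem spiralContinuable_mul_poch_div {δ : ℝ} (h0 : 0 < δ) (h1 : δ ≤ 1) (a : Multiset ℂ) :
    ∀ b : Multiset ℂ, a.card = b.card → (∀ x ∈ a, δ < x.re) → (∀ x ∈ b, ∀ n : ℕ, x ≠ -(n : ℂ)) →
      ∀ q ∈ binomSpan, SpiralContinuable δ fun n => q n * (poch a n / poch b n) := by
  induction a using Multiset.induction with
  | empty =>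
    intro b hb _ _ q hq
    obtain rfl : b = 0 := Multiset.card_eq_zero.1 (by simpa using hb.symm)
    simpa [poch_zero] using spiralContinuable_of_mem_binomSpan h0.le h1 hq
  | cons x a ih =>
    intro b hb ha hbn q hq
    obtain ⟨y, b, rfl⟩ : ∃ y b', b = y ::ₘ b' := by
      rcases Multiset.empty_or_exists_mem b with rfl | ⟨y, hy⟩
      · simp at hb
      · exact ⟨y, _, (Multiset.cons_erase hy).symm⟩
    have hy := hbn y (Multiset.mem_cons_self y b)
    -- N is large enough for Re(y + N) ≥ Re x + 1. The exchange is 1/(y)_n = (y+n)_N / ((y)_N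
    -- (y+N)_n).
    obtain ⟨N, hN⟩ := exists_nat_ge (x.re + 1 - y.re)
    have key := (ih b (by simpa using hb) (fun z hz => ha z (Multiset.mem_cons_of_mem hz))
      (fun z hz => hbn z (Multiset.mem_cons_of_mem hz)) _
      (pochhammer_mul_mem_binomSpan hq y N)).mul_pochhammer_div (a := x) (b := y + N) h0
      (ha x (Multiset.mem_cons_self x a)) (by simp; linarith)
    convert key.smul ((ascPochhammer ℂ N).eval y)⁻¹ using 1
    ext n
    have e : (ascPochhammer ℂ N).eval y * (ascPochhammer ℂ n).eval (y + N) =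
        (ascPochhammer ℂ n).eval y * (ascPochhammer ℂ N).eval (y + n) := by
      rw [← pochhammer_add, ← pochhammer_add, add_comm]
    have n1 := ascPochhammer_eval_ne_zero hy n
    have n2 := ascPochhammer_eval_ne_zero hy N
    have n3 : (ascPochhammer ℂ n).eval (y + N) ≠ 0 := ascPochhammer_eval_ne_zero (fun m hm =>
      hy (m + N) (by push_cast; linear_combination hm)) n
    have e' : (ascPochhammer ℂ N).eval (y + n) / (ascPochhammer ℂ n).eval (y + N) =
        (ascPochhammer ℂ N).eval y / (ascPochhammer ℂ n).eval y := by
      rw [div_eq_div_iff n3 n1]; linear_combination -e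
    rw [poch_cons, poch_cons]
    simp only [Pi.smul_apply, smul_eq_mul]
    calc _ = q n * (ascPochhammer ℂ n).eval x * (poch a n / poch b n) *
          (((ascPochhammer ℂ N).eval y)⁻¹ * ((ascPochhammer ℂ N).eval y /
            (ascPochhammer ℂ n).eval y)) := by
            rw [div_eq_mul_inv ((ascPochhammer ℂ N).eval y), inv_mul_cancel_left₀ n2,
              mul_div_mul_comm]; ring
      _ = _ := by rw [← e']; ring

/-- The hypergeometric series continues to the complements of spirals close to `[1, ∞)`. -/
theorem spiralContinuable_coeff {a b : Multiset ℂ} (hcard : a.card = b.card + 1)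
    (ha : ∀ x ∈ a, 0 < x.re) (hb : ∀ x ∈ b, ∀ n : ℕ, x ≠ -(n : ℂ)) :
    ∃ δ, 0 < δ ∧ δ ≤ 1 ∧ SpiralContinuable δ (coeff a b) := by
  obtain ⟨δ, h0, h1, hδ⟩ : ∃ δ : ℝ, 0 < δ ∧ δ ≤ 1 ∧ ∀ x ∈ a, δ < x.re := by
    clear hcard
    induction a using Multiset.induction with
    | empty => exact ⟨1, one_pos, le_rfl, by simp⟩
    | cons x a ih =>
      obtain ⟨δ, h0, h1, hδ⟩ := ih fun z hz => ha z (Multiset.mem_cons_of_mem hz)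
      have hx := ha x (Multiset.mem_cons_self x a)
      refine ⟨min δ (x.re / 2), lt_min h0 (by linarith), (min_le_left _ _).trans h1, fun z hz => ?_⟩
      rcases Multiset.mem_cons.1 hz with rfl | hz
      · exact lt_of_le_of_lt (min_le_right _ _) (by linarith)
      · exact lt_of_le_of_lt (min_le_left _ _) (hδ z hz)
  refine ⟨δ, h0, h1, ?_⟩
  -- The factorial n! = (1)_n serves as one more lower parameter, which balances the two lists.
  have := spiralContinuable_mul_poch_div h0 h1 a (1 ::ₘ b) (by simpa using hcard) hδ
    (fun z hz => ?_) 1 (Submodule.subset_span ⟨0, by ext; simp⟩)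
  · convert this using 1
    ext n
    rw [coeff, poch_cons, ascPochhammer_eval_one, Pi.one_apply, one_mul, mul_comm (poch b n)]
  · rcases Multiset.mem_cons.1 hz with rfl | hz
    · exact ne_neg_natCast_of_re_pos (by simp)
    · exact hb z hz

/-! ### The function on the cut plane and its boundary values -/

theorem isPreconnected_cutPlane : IsPreconnected cutPlane := by
  have hs : StarConvex ℝ (0 : ℂ) cutPlane := by
    rw [starConvex_zero_iff]
    intro w hw t h0 h1
    simp only [cutPlane, Set.mem_ofPred_eq, Complex.smul_re, Complex.smul_im, smul_eq_mul] at hw ⊢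
    rcases h0.eq_or_lt with rfl | h0
    · left; simp
    rcases hw with hw | hw
    · left
      nlinarith [mul_lt_mul_of_pos_left hw h0]
    · exact Or.inr (mul_ne_zero h0.ne' hw)
  exact (hs.isPathConnected (Or.inl (by simp))).isConnected.isPreconnected

theorem mem_cutPlane_of_norm_lt {w : ℂ} (h : ‖w‖ < 1) : w ∈ cutPlane :=
  Or.inl (lt_of_le_of_lt (Complex.re_le_norm w) h)

/-- Holomorphic functions whose power series at `0` have the same coefficients agree on every
connected open set that contains `0`. -/
theorem eqOn_of_hasSum {U : Set ℂ} (hU : IsOpen U) (hc : IsPreconnected U) (h0 : (0 : ℂ) ∈ U)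
    {F G : ℂ → ℂ} (hF : DifferentiableOn ℂ F U) (hG : DifferentiableOn ℂ G U)
    (h : ∀ w : ℂ, ‖w‖ < 1 → F w = G w) : Set.EqOn F G U := by
  refine (hF.analyticOnNhd hU).eqOn_of_preconnected_of_eventuallyEq (hG.analyticOnNhd hU) hc h0 ?_
  filter_upwards [(isOpen_lt continuous_norm continuous_const).mem_nhds
    (show ‖(0 : ℂ)‖ < 1 by simp)] with w hw
  exact h w hw

section Continuation

variable {a b : Multiset ℂ}

theorem isContinuation_hyp (hcard : a.card = b.card + 1) (ha : ∀ x ∈ a, 0 < x.re)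
    (hb : ∀ x ∈ b, ∀ n : ℕ, x ≠ -(n : ℂ)) : IsContinuation a b (hyp a b) := by
  have h : ∃ f : ℂ → ℂ, IsContinuation a b f := by
    obtain ⟨δ, -, -, hδ⟩ := spiralContinuable_coeff hcard ha hb
    obtain ⟨F, hF, hs, -⟩ := hδ.self_of_nhds
    rw [spiralPlane_zero] at hF
    exact ⟨F, hF.analyticOnNhd isOpen_cutPlane, hs⟩
  have h' : hyp a b = h.choose := by
    funext w
    rw [hyp, dif_pos h]
  rw [h']
  exact h.choose_spec

theorem differentiableOn_hyp (hcard : a.card = b.card + 1) (ha : ∀ x ∈ a, 0 < x.re)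
    (hb : ∀ x ∈ b, ∀ n : ℕ, x ≠ -(n : ℂ)) : DifferentiableOn ℂ (hyp a b) cutPlane :=
  (isContinuation_hyp hcard ha hb).1.differentiableOn

theorem norm_hyp_le (hcard : a.card = b.card + 1) (ha : ∀ x ∈ a, 0 < x.re)
    (hb : ∀ x ∈ b, ∀ n : ℕ, x ≠ -(n : ℂ)) :
    ∃ δ C : ℝ, 0 < δ ∧ δ ≤ 1 ∧
      ∀ w : ℂ, w.re ≤ 0 → w ≠ 0 → ‖hyp a b w‖ ≤ C * ‖w‖ ^ (-δ) := by
  obtain ⟨δ, h0, h1, hδ⟩ := spiralContinuable_coeff hcard ha hb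
  obtain ⟨F, hF, hs, hd⟩ := hδ.self_of_nhds
  obtain ⟨C, hC⟩ := hd rfl
  rw [spiralPlane_zero] at hF
  refine ⟨δ, C, h0, h1, fun w hw hw0 => ?_⟩
  have hc := isContinuation_hyp hcard ha hb
  rw [eqOn_of_hasSum isOpen_cutPlane isPreconnected_cutPlane (Or.inl (by simp))
    hc.1.differentiableOn hF (fun w hw => (hc.2 w hw).unique (hs w hw))
    (Or.inl (by linarith) : w ∈ cutPlane)]
  exact hC w hw hw0

/-- The spiral point of modulus r has argument α log r. While |α| log r < π, the outgoing spiral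
stays strictly on the side of the real axis given by the sign of α, hence misses the closed opposite
side except at its start 1. -/
theorem mem_spiralPlane_of_im_mul_nonpos {α : ℝ} (hα : α ≠ 0) {w : ℂ}
    (h1 : |α| * Real.log ‖w‖ < Real.pi) (h2 : w.im * α ≤ 0) (h3 : 1 < ‖w‖ ∨ w.im * α < 0) :
    w ∈ spiralPlane α := by
  by_contra h
  simp only [spiralPlane, Set.mem_ofPred_eq, not_or, not_lt, ne_eq, not_not] at h
  obtain ⟨hn, he⟩ := h
  have hL : 0 ≤ Real.log ‖w‖ := Real.log_nonneg hn
  have him : w.im = ‖w‖ * Real.sin (α * Real.log ‖w‖) := by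
    rw [he, Complex.exp_im, ← he]
    simp [Real.exp_log (lt_of_lt_of_le one_pos hn)]
  rcases hL.eq_or_lt with hL | hL
  · rw [← hL, mul_zero, Real.sin_zero, mul_zero] at him
    rcases h3 with h3 | h3
    · exact (Real.log_pos h3).ne hL
    · rw [him, zero_mul] at h3; exact h3.false
  · have hpos : 0 < α * Real.sin (α * Real.log ‖w‖) := by
      rcases lt_or_gt_of_ne hα with h | h
      · rw [abs_of_neg h] at h1
        exact mul_pos_of_neg_of_neg h (Real.sin_neg_of_neg_of_neg_pi_lt
          (mul_neg_of_neg_of_pos h hL) (by linarith))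
      · rw [abs_of_pos h] at h1
        exact mul_pos h (Real.sin_pos_of_pos_of_lt_pi (mul_pos h hL) h1)
    rw [him] at h2
    nlinarith

/-- One-sided boundary values on the cut, from above for `s = 1` and from below for `s = -1`. -/
theorem exists_tendsto_hyp (hcard : a.card = b.card + 1) (ha : ∀ x ∈ a, 0 < x.re)
    (hb : ∀ x ∈ b, ∀ n : ℕ, x ≠ -(n : ℂ)) {t : ℝ} (ht : 1 < t) {s : ℝ} (hs : s ≠ 0) :
    ∃ L, Tendsto (fun ε : ℝ => hyp a b (t + ((s * ε : ℝ) : ℂ) * Complex.I)) (𝓝[>] 0) (𝓝 L) := by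
  obtain ⟨δ, -, -, hδ⟩ := spiralContinuable_coeff hcard ha hb
  have hc := isContinuation_hyp hcard ha hb
  have hlog : 0 < Real.log (t + 1) := Real.log_pos (by linarith)
  have e1 : ∀ᶠ α in 𝓝 (0 : ℝ), |α| * Real.log (t + 1) < Real.pi := by
    have : ContinuousAt (fun α : ℝ => |α| * Real.log (t + 1)) 0 := by fun_prop
    exact this.eventually (gt_mem_nhds (by simpa using Real.pi_pos))
  have e2 : Tendsto (fun x : ℝ => -s * x) (𝓝[>] 0) (𝓝 0) := by
    have : Tendsto (fun x : ℝ => -s * x) (𝓝 0) (𝓝 (-s * 0)) := by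
      exact (continuous_const.mul continuous_id).tendsto 0
    rw [mul_zero] at this
    exact this.mono_left nhdsWithin_le_nhds
  -- The tilt α = -s x has the sign opposite to s, so the spiral bends away from the side of
  -- approach. It is small enough that the spiral does not complete a half turn within |w| < t + 1.
  obtain ⟨x, ⟨⟨F, hF, hFs, -⟩, hx1⟩, hx0⟩ :=
    ((e2.eventually (hδ.and e1)).and self_mem_nhdsWithin).exists
  set α := -s * x
  have hx0 : 0 < x := hx0
  have hα : α ≠ 0 := mul_ne_zero (neg_ne_zero.2 hs) hx0.ne'
  have hsα : s * α < 0 := by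
    have : 0 < s ^ 2 * x := by positivity
    simp only [α]; nlinarith
  have hlogle : ∀ w : ℂ, ‖w‖ < t + 1 → |α| * Real.log ‖w‖ < Real.pi := by
    intro w hw
    by_cases hw0 : w = 0
    · simp [hw0, Real.pi_pos]
    refine lt_of_le_of_lt ?_ hx1
    exact mul_le_mul_of_nonneg_left (Real.log_le_log (norm_pos_iff.2 hw0) hw.le) (abs_nonneg _)
  set V : Set ℂ := {w : ℂ | w.im * α < 0} ∩ Metric.ball 0 (t + 1)
  have hVo : IsOpen V :=
    (isOpen_lt (Complex.continuous_im.mul continuous_const) continuous_const).inter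
      Metric.isOpen_ball
  have hVc : Convex ℝ V := by
    refine Convex.inter ?_ (convex_ball _ _)
    have : IsLinearMap ℝ fun w : ℂ => w.im * α :=
      ⟨fun x y => by simp [add_mul], fun c x => by simp [mul_assoc]⟩
    exact convex_halfSpace_lt this 0
  have hVα : ∀ w ∈ V, w ∈ spiralPlane α := fun w hw =>
    mem_spiralPlane_of_im_mul_nonpos hα (hlogle w (by simpa using hw.2)) (le_of_lt hw.1)
      (Or.inr hw.1)
  have hVcut : ∀ w ∈ V, w ∈ cutPlane := fun w hw => Or.inr fun h => by
    have := hw.1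
    simp [h] at this
  -- The disc and the half-disc V are convex and share the point v, a multiple of i of modulus less
  -- than 1 on the side where Im · α < 0.
  have hUc : IsPreconnected (Metric.ball (0 : ℂ) 1 ∪ V) := by
    set v : ℂ := ((-(α / (1 + |α|)) / 2 : ℝ) : ℂ) * Complex.I with hv
    have hvn : ‖v‖ < 1 := by
      rw [hv, norm_mul, Complex.norm_I, mul_one, Complex.norm_real, Real.norm_eq_abs, abs_div,
        abs_neg, abs_div, abs_of_pos (show (0 : ℝ) < 1 + |α| by positivity), abs_two,
        div_div, div_lt_one (by positivity)]
      nlinarith [abs_nonneg α]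
    refine IsPreconnected.union v (by simpa using hvn) ⟨?_, ?_⟩
      (convex_ball _ _).isPreconnected hVc.isPreconnected
    · have h1 : v.im * α = -(α ^ 2 / (1 + |α|) / 2) := by
        rw [hv, Complex.im_ofReal_mul, Complex.I_im]; ring
      have : 0 < α ^ 2 / (1 + |α|) / 2 := by positivity
      simp only [Set.mem_ofPred_eq, h1]
      linarith
    · simp only [Metric.mem_ball, dist_zero_right]
      linarith
  have heq := eqOn_of_hasSum (Metric.isOpen_ball.union hVo) hUc
    (Or.inl (Metric.mem_ball_self one_pos)) (F := hyp a b) (G := F)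
    (hc.1.differentiableOn.mono fun w hw => hw.elim
      (fun h => mem_cutPlane_of_norm_lt (by simpa using h)) (hVcut w))
    (hF.mono fun w hw => hw.elim
      (fun h => mem_spiralPlane_of_norm_lt (by simpa using h)) (hVα w))
    (fun w hw => (hc.2 w hw).unique (hFs w hw))
  have htn : ‖(t : ℂ)‖ = t := by
    rw [Complex.norm_real, Real.norm_of_nonneg (by linarith)]
  have htα : (t : ℂ) ∈ spiralPlane α :=
    mem_spiralPlane_of_im_mul_nonpos hα (hlogle _ (by rw [htn]; linarith)) (by simp)
      (Or.inl (by rw [htn]; exact ht))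
  -- The point t lies inside the domain of the tilted continuation F, so F(t) is the boundary value.
  have hFc : ContinuousAt F t :=
    (hF.differentiableAt ((isOpen_spiralPlane α).mem_nhds htα)).continuousAt
  have hpath : Tendsto (fun ε : ℝ => (t : ℂ) + ((s * ε : ℝ) : ℂ) * Complex.I) (𝓝[>] 0)
      (𝓝 (t : ℂ)) := by
    have : Continuous fun ε : ℝ => (t : ℂ) + ((s * ε : ℝ) : ℂ) * Complex.I := by fun_prop
    have := (this.tendsto 0).mono_left (nhdsWithin_le_nhds (s := Set.Ioi (0 : ℝ)))
    simpa using this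
  refine ⟨F t, (hFc.tendsto.comp hpath).congr' ?_⟩
  have hball : Metric.ball (0 : ℂ) (t + 1) ∈ 𝓝 (t : ℂ) :=
    Metric.isOpen_ball.mem_nhds (by simp only [Metric.mem_ball, dist_zero_right, htn]; linarith)
  filter_upwards [hpath.eventually hball, self_mem_nhdsWithin] with ε hε hε0
  refine (heq (Or.inr ⟨?_, hε⟩)).symm
  have hε0 : 0 < ε := hε0
  have : s * ε * α < 0 := by nlinarith
  simpa using this

theorem hasBoundaryValues_of_ne_one (hcard : a.card = b.card + 1) (ha : ∀ x ∈ a, 0 < x.re)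
    (hb : ∀ x ∈ b, ∀ n : ℕ, x ≠ -(n : ℂ)) {t : ℝ} (ht : t ≠ 1) : HasBoundaryValues a b t := by
  rcases lt_or_gt_of_ne ht with ht | ht
  · have hc : ContinuousAt (hyp a b) (t : ℂ) := ((differentiableOn_hyp hcard ha hb).differentiableAt
      (isOpen_cutPlane.mem_nhds (Or.inl (by simpa using ht)))).continuousAt
    refine ⟨⟨_, hc.tendsto.comp ?_⟩, ⟨_, hc.tendsto.comp ?_⟩⟩
    · have : Continuous fun ε : ℝ => (t : ℂ) + (ε : ℂ) * Complex.I := by fun_prop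
      simpa using (this.tendsto 0).mono_left (nhdsWithin_le_nhds (s := Set.Ioi (0 : ℝ)))
    · have : Continuous fun ε : ℝ => (t : ℂ) - (ε : ℂ) * Complex.I := by fun_prop
      simpa using (this.tendsto 0).mono_left (nhdsWithin_le_nhds (s := Set.Ioi (0 : ℝ)))
  · obtain ⟨L, hL⟩ := exists_tendsto_hyp hcard ha hb ht one_ne_zero
    obtain ⟨M, hM⟩ := exists_tendsto_hyp hcard ha hb ht (neg_ne_zero.2 one_ne_zero)
    refine ⟨⟨L, by simpa [IsAbove] using hL⟩, ⟨M, by simpa [IsBelow, sub_eq_add_neg] using hM⟩⟩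

end Continuation

/-! ### Pochhammer symbols in steps of three -/

theorem poch_shift (c : Multiset ℂ) (m n : ℕ) :
    poch c (m + n) = poch c m * poch (shift c m) n := by
  induction c using Multiset.induction with
  | empty => simp [poch, shift]
  | cons x c ih =>
    rw [shift, Multiset.map_cons, poch_cons, poch_cons, poch_cons, ← shift, ih, pochhammer_add]
    ring

theorem pochhammer_three_mul (x : ℂ) (k : ℕ) : (ascPochhammer ℂ (3 * k)).eval x =
    27 ^ k * ((ascPochhammer ℂ k).eval (x / 3) * ((ascPochhammer ℂ k).eval ((x + 1) / 3) *
      (ascPochhammer ℂ k).eval ((x + 2) / 3))) := by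
  induction k with
  | zero => simp
  | succ k ih =>
    rw [show 3 * (k + 1) = 3 * k + 1 + 1 + 1 by ring, ascPochhammer_succ_eval,
      ascPochhammer_succ_eval, ascPochhammer_succ_eval, ascPochhammer_succ_eval,
      ascPochhammer_succ_eval, ascPochhammer_succ_eval, ih]
    push_cast
    ring

theorem poch_three_mul (c : Multiset ℂ) (k : ℕ) :
    poch c (3 * k) = 27 ^ (k * c.card) * poch (delta c 3) k := by
  induction c using Multiset.induction with
  | empty => simp [poch, delta]
  | cons x c ih =>
    have h : poch (delta (x ::ₘ c) 3) k = (ascPochhammer ℂ k).eval (x / 3) *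
        ((ascPochhammer ℂ k).eval ((x + 1) / 3) * (ascPochhammer ℂ k).eval ((x + 2) / 3)) *
          poch (delta c 3) k := by
      simp only [delta, poch, Multiset.cons_bind, Multiset.map_add, Multiset.prod_add,
        Multiset.map_map]
      congr 1
      simp [Multiset.range_succ]
      ring
    rw [poch_cons, h, ih, pochhammer_three_mul, Multiset.card_cons]
    ring

theorem poch_ne_zero {b : Multiset ℂ} (hb : ∀ x ∈ b, ∀ n : ℕ, x ≠ -(n : ℂ)) (n : ℕ) :
    poch b n ≠ 0 := by
  induction b using Multiset.induction with
  | empty => simp [poch]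
  | cons x c ih =>
    rw [poch_cons]
    exact mul_ne_zero (ascPochhammer_eval_ne_zero (hb x (Multiset.mem_cons_self x c)) n)
      (ih fun z hz => hb z (Multiset.mem_cons_of_mem hz))

theorem two_mul_poch_three (n : ℕ) :
    2 * poch {3} n = (n.factorial : ℂ) * ((n : ℂ) + 1) * ((n : ℂ) + 2) := by
  induction n with
  | zero => simp [poch]
  | succ n ih =>
    have h : poch {3} (n + 1) = poch {3} n * (3 + n) := by
      simp [poch, ascPochhammer_succ_eval]
    rw [h, ← mul_assoc, ih, Nat.factorial_succ]
    push_cast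
    ring

theorem card_shift (c : Multiset ℂ) (m : ℂ) : (shift c m).card = c.card := by simp [shift]

theorem card_delta (c : Multiset ℂ) : (delta c 3).card = 3 * c.card := by
  simp [delta]; ring

/-- Splitting (c)_{m+3k} into (c)_m, a power of 27 and (Δ(c+m,3))_k recovers the coefficient of
index m + 3k. The powers of 27 balance because a has one component more than b. The weights come
from 2·(3)_n = n!(n+1)(n+2), for n = k and n = m + 3k. -/
theorem coeff_psi {a b : Multiset ℂ} (hcard : a.card = b.card + 1)
    (hb : ∀ x ∈ b, ∀ n : ℕ, x ≠ -(n : ℂ)) (m k : ℕ) :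
    poch a m / (poch {3} m * poch b m) * coeff (psiUpper a m) (psiLower b m) k =
      ((k : ℂ) + 1) * ((k : ℂ) + 2) * coeff a b (m + 3 * k) /
        (((m + 3 * k : ℕ) + 1) * ((m + 3 * k : ℕ) + 2)) := by
  have hb1 := poch_ne_zero hb (m + 3 * k)
  have hadd : ∀ c d : Multiset ℂ, poch (c + d) k = poch c k * poch d k := by
    intro c d; simp [poch]
  have h3 : ∀ n : ℕ, poch {3} n ≠ 0 := fun n => by
    refine poch_ne_zero (fun x hx => ?_) n
    rw [Multiset.mem_singleton] at hx
    subst hx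
    exact ne_neg_natCast_of_re_pos (by simp)
  have h31 := h3 (m + 3 * k)
  have hs : shift {3} (m : ℂ) = {(m : ℂ) + 3} := by simp [shift, add_comm]
  have t1 := two_mul_poch_three (m + 3 * k)
  have t2 := two_mul_poch_three k
  rw [poch_shift, poch_three_mul, card_shift] at hb1
  rw [poch_shift, hs, poch_three_mul, Multiset.card_singleton, mul_one] at h31 t1
  have hfac : (((m + 3 * k).factorial : ℕ) : ℂ) ≠ 0 := by exact_mod_cast Nat.factorial_ne_zero _
  have hfac' : ((k.factorial : ℕ) : ℂ) ≠ 0 := by exact_mod_cast Nat.factorial_ne_zero _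
  have n1 : ((m + 3 * k : ℕ) : ℂ) + 1 ≠ 0 := Nat.cast_add_one_ne_zero _
  have n2 : ((m + 3 * k : ℕ) : ℂ) + 2 ≠ 0 := by exact_mod_cast Nat.succ_ne_zero (m + 3 * k + 1)
  rw [coeff, coeff, psiUpper, psiLower, hadd, hadd, poch_shift a, poch_shift b, poch_three_mul,
    poch_three_mul, card_shift, card_shift, hcard]
  set n : ℂ := ((m + 3 * k : ℕ) : ℂ)
  simp only [mul_ne_zero_iff] at hb1 h31
  obtain ⟨hB, h27, hB'⟩ := hb1
  obtain ⟨hT, h27', hD⟩ := h31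
  have hpow : (27 : ℂ) ^ (k * (b.card + 1)) = 27 ^ (k * b.card) * 27 ^ k := by
    rw [mul_add, mul_one, pow_add]
  rw [hpow, div_mul_div_comm, mul_div_assoc', div_div, div_eq_div_iff
    (by simp [hT, hB, hB', hD, hfac']) (by simp [hB, h27, hB', hfac, n1, n2])]
  generalize (27 : ℂ) ^ (k * b.card) = r
  generalize poch (delta (shift b m) 3) k = B'
  generalize poch (delta (shift a m) 3) k = A'
  linear_combination (-(poch a m * A' * poch {3} k * poch b m * r * B')) * t1 +
    (poch a m * A' * poch b m * r * B' * poch {3} m * 27 ^ k * poch (delta {(m : ℂ) + 3} 3) k) * t2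

/-! ### Cube roots of unity and the closed form in the unit disc -/

/-- The primitive cube root of unity `exp (2 π i / 3)`. -/
def omega : ℂ := ⟨-1 / 2, Real.sqrt 3 / 2⟩

theorem omega_sq : omega ^ 2 = (starRingEnd ℂ) omega := by
  have h : Real.sqrt 3 * Real.sqrt 3 = 3 := Real.mul_self_sqrt (by norm_num)
  rw [sq]
  apply Complex.ext
  · simp [omega]; linear_combination (-1 / 4) * h
  · simp [omega]; ring

theorem omega_pow_three : omega ^ 3 = 1 := by
  have h : Real.sqrt 3 * Real.sqrt 3 = 3 := Real.mul_self_sqrt (by norm_num)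
  rw [pow_succ, omega_sq, ← Complex.normSq_eq_conj_mul_self, Complex.normSq_apply]
  norm_cast
  simp only [omega]
  linear_combination (1 / 4) * h

theorem omega_sub_omega_sq : omega - omega ^ 2 = Real.sqrt 3 * Complex.I := by
  rw [omega_sq]
  apply Complex.ext <;> simp [omega]

theorem norm_omega : ‖omega‖ = 1 := by
  have h : ‖omega‖ ^ 3 = 1 := by rw [← norm_pow, omega_pow_three, norm_one]
  exact (pow_eq_one_iff_of_nonneg (norm_nonneg _) (by norm_num)).1 h

theorem sqrt_three_mul_I_ne_zero : (Real.sqrt 3 : ℂ) * Complex.I ≠ 0 :=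
  mul_ne_zero (by norm_num) Complex.I_ne_zero

theorem delta_eq (c : Multiset ℂ) (k : ℕ) :
    delta c k = c.bind fun x => (Multiset.range k).map fun j : ℕ => (x + (j : ℂ)) / (k : ℂ) := by
  simp [delta, Multiset.bind_def, Multiset.pure_def, Multiset.bind_singleton]

/-- The summand `ψ_m` off the cut. -/
def psiC (a b : Multiset ℂ) (m : ℕ) (y : ℂ) : ℂ :=
  y ^ (m + 2) * poch a m / (poch {3} m * poch b m) * hyp (psiUpper a m) (psiLower b m) (y ^ 3)

/-- The numerator off the cut. -/
def numeratorC (a b : Multiset ℂ) (y : ℂ) : ℂ :=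
  psiC a b 1 y - 2 * psiC a b 2 y + 2 * psiC a b 4 y - psiC a b 5 y

/-- The closed form of the numerator. -/
def jump (f : ℂ → ℂ) (y : ℂ) : ℂ :=
  y ^ 2 / (3 * (Real.sqrt 3 * Complex.I)) * (f (omega * y) - f (omega ^ 2 * y))

theorem re_pos_of_mem_psiUpper {a : Multiset ℂ} (ha : ∀ x ∈ a, 0 < x.re) (m : ℕ) :
    ∀ x ∈ psiUpper a m, 0 < x.re := by
  intro x hx
  simp only [psiUpper, delta_eq, shift, Multiset.mem_add, Multiset.mem_singleton, Multiset.mem_bind,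
    Multiset.mem_map] at hx
  rcases hx with rfl | ⟨_, ⟨x, hx, rfl⟩, j, -, rfl⟩
  · simp
  · have := ha x hx
    rw [show ((3 : ℕ) : ℂ) = ((3 : ℝ) : ℂ) by simp, Complex.div_ofReal_re]
    simp
    positivity

theorem ne_neg_of_mem_psiLower {b : Multiset ℂ} (hb : ∀ x ∈ b, ∀ n : ℕ, x ≠ -(n : ℂ)) (m : ℕ) :
    ∀ x ∈ psiLower b m, ∀ n : ℕ, x ≠ -(n : ℂ) := by
  intro x hx n hn
  simp only [psiLower, delta_eq, shift, Multiset.mem_add, Multiset.mem_singleton, Multiset.mem_bind,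
    Multiset.mem_map] at hx
  rcases hx with ⟨_, ⟨x, hx, rfl⟩, j, -, rfl⟩ | ⟨_, rfl, j, -, rfl⟩
  · apply hb x hx (3 * n + m + j)
    push_cast at hn ⊢
    linear_combination 3 * hn
  · have h : ((m + 3 + j + 3 * n : ℕ) : ℂ) = 0 := by
      push_cast at hn ⊢
      linear_combination 3 * hn
    have := Nat.cast_eq_zero.1 h
    omega

theorem card_psiUpper {a b : Multiset ℂ} (hcard : a.card = b.card + 1) (m : ℕ) :
    (psiUpper a m).card = (psiLower b m).card + 1 := by
  simp only [psiUpper, psiLower, Multiset.card_add, card_delta, card_shift,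
    Multiset.card_singleton, hcard]
  ring

section Identity

variable {a b : Multiset ℂ}

theorem hasSum_psiC (hcard : a.card = b.card + 1) (ha : ∀ x ∈ a, 0 < x.re)
    (hb : ∀ x ∈ b, ∀ n : ℕ, x ≠ -(n : ℂ)) (m : ℕ) {y : ℂ} (hy : ‖y‖ < 1) :
    HasSum (fun k : ℕ => y ^ 2 * (((k : ℂ) + 1) * ((k : ℂ) + 2) * coeff a b (m + 3 * k) /
        (((m + 3 * k : ℕ) + 1) * ((m + 3 * k : ℕ) + 2)) * y ^ (m + 3 * k))) (psiC a b m y) := by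
  have h3 : ‖y ^ 3‖ < 1 := by
    rw [norm_pow]; exact pow_lt_one₀ (norm_nonneg _) hy (by norm_num)
  have h := (((isContinuation_hyp (card_psiUpper hcard m) (re_pos_of_mem_psiUpper ha m)
    (ne_neg_of_mem_psiLower hb m)).2 _ h3).mul_left
      (y ^ (m + 2) * poch a m / (poch {3} m * poch b m)))
  rw [← psiC] at h
  refine h.congr_fun fun k => ?_
  rw [← coeff_psi hcard hb]
  ring

theorem hasSum_third {d : ℕ → ℂ} {s t : ℂ}
    (h1 : HasSum (fun k => d (1 + 3 * k)) s) (h2 : HasSum (fun k => d (2 + 3 * k)) t)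
    (h0 : ∀ k, d (3 * k) = 0) : HasSum d (s + t) := by
  have i1 : Function.Injective fun k : ℕ => 1 + 3 * k := fun i j h => by simpa using h
  have i2 : Function.Injective fun k : ℕ => 2 + 3 * k := fun i j h => by simpa using h
  have e1 : HasSum (fun n => if n % 3 = 1 then d n else 0) s := by
    refine (i1.hasSum_iff fun n hn => ?_).1 ?_
    · rw [if_neg]
      exact fun h => hn ⟨n / 3, by simp only; omega⟩
    · convert h1 using 2 with k
      simp only [Function.comp]
      rw [if_pos (by omega)]
  have e2 : HasSum (fun n => if n % 3 = 2 then d n else 0) t := by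
    refine (i2.hasSum_iff fun n hn => ?_).1 ?_
    · rw [if_neg]
      exact fun h => hn ⟨n / 3, by simp only; omega⟩
    · convert h2 using 2 with k
      simp only [Function.comp]
      rw [if_pos (by omega)]
  convert e1.add e2 using 2 with n
  obtain h | h | h : n % 3 = 0 ∨ n % 3 = 1 ∨ n % 3 = 2 := by omega
  · rw [if_neg (by omega), if_neg (by omega), show n = 3 * (n / 3) by omega, h0, add_zero]
  · rw [if_pos h, if_neg (by omega), add_zero]
  · rw [if_neg (by omega), if_pos h, zero_add]

/-- For n = 1 + 3k the weights of ψ_1 + 2ψ_4 add to (k+1)(k+2) + 2k(k+1) = (k+1)(3k+2), which over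
(n+1)(n+2) is 1/3. For n = 2 + 3k those of 2ψ_2 + ψ_5 add to (k+1)(3k+4), again 1/3 after division.
On the other side ω^n - ω^{2n} is i√3, -i√3 or 0 according to n mod 3. -/
theorem numeratorC_eq_jump_of_norm_lt (hcard : a.card = b.card + 1) (ha : ∀ x ∈ a, 0 < x.re)
    (hb : ∀ x ∈ b, ∀ n : ℕ, x ≠ -(n : ℂ)) {y : ℂ} (hy : ‖y‖ < 1) :
    numeratorC a b y = jump (hyp a b) y := by
  have hshift : ∀ (c : ℕ → ℂ) {s : ℂ}, HasSum (fun k : ℕ => ((k : ℂ) + 1) * ((k : ℂ) + 2) *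
      c (k + 1)) s → HasSum (fun k : ℕ => (k : ℂ) * ((k : ℂ) + 1) * c k) s := by
    intro c s h
    rw [← hasSum_nat_add_iff' 1]
    simp only [Finset.range_one, Finset.sum_singleton, Nat.cast_zero, zero_mul, sub_zero]
    refine h.congr_fun fun k => ?_
    push_cast
    ring
  -- Reindexing ψ_{r+3} by k ↦ k + 1 aligns it with ψ_r; the new term k = 0 is harmless because its
  -- weight k(k+1) vanishes.
  have hr : ∀ r : ℕ, HasSum (fun k : ℕ => (k : ℂ) * ((k : ℂ) + 1) *
      (y ^ 2 * (coeff a b (r + 3 * k) / (((r + 3 * k : ℕ) + 1) * ((r + 3 * k : ℕ) + 2)) *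
        y ^ (r + 3 * k)))) (psiC a b (r + 3) y) := by
    intro r
    refine hshift (fun k => y ^ 2 * (coeff a b (r + 3 * k) /
      (((r + 3 * k : ℕ) + 1) * ((r + 3 * k : ℕ) + 2)) * y ^ (r + 3 * k))) ?_
    refine (hasSum_psiC hcard ha hb (r + 3) hy).congr_fun fun k => ?_
    rw [show r + 3 * (k + 1) = r + 3 + 3 * k by ring]
    ring
  have s1 := (hasSum_psiC hcard ha hb 1 hy).add ((hr 1).mul_left 2)
  have s2 := ((hasSum_psiC hcard ha hb 2 hy).mul_left 2).add (hr 2)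
  have hc := (isContinuation_hyp hcard ha hb).2
  have hw : ∀ j : ℕ, ‖omega ^ j * y‖ < 1 := fun j => by
    rw [norm_mul, norm_pow, norm_omega, one_pow, one_mul]; exact hy
  have hj := ((hc _ (hw 1)).sub (hc _ (hw 2))).mul_left (y ^ 2 / (3 * (Real.sqrt 3 * Complex.I)))
  have hI := sqrt_three_mul_I_ne_zero
  have hw3 : ∀ k : ℕ, omega ^ (3 * k) = 1 := fun k => by rw [pow_mul, omega_pow_three, one_pow]
  have key := hasSum_third (d := fun n => y ^ 2 / (3 * (Real.sqrt 3 * Complex.I)) *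
      (coeff a b n * (omega ^ 1 * y) ^ n - coeff a b n * (omega ^ 2 * y) ^ n))
    (s := psiC a b 1 y + 2 * psiC a b (1 + 3) y) (t := -(2 * psiC a b 2 y + psiC a b (2 + 3) y))
    ?_ ?_ ?_
  · rw [pow_one] at key hj
    rw [numeratorC, jump, hj.unique key]
    ring
  · refine s1.congr_fun fun k => ?_
    have n1 : (((1 + 3 * k : ℕ) : ℂ) + 1) ≠ 0 := Nat.cast_add_one_ne_zero _
    have n2 : (((1 + 3 * k : ℕ) : ℂ) + 2) ≠ 0 := by exact_mod_cast Nat.succ_ne_zero (1 + 3 * k + 1)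
    have e : (omega ^ 1 * y) ^ (1 + 3 * k) = omega * y ^ (1 + 3 * k) := by
      rw [mul_pow, pow_one, pow_add omega, hw3]; ring
    have e' : (omega ^ 2 * y) ^ (1 + 3 * k) = omega ^ 2 * y ^ (1 + 3 * k) := by
      rw [mul_pow, ← pow_mul, show 2 * (1 + 3 * k) = 2 + 3 * (2 * k) by ring, pow_add omega, hw3]
      ring
    have e2 : coeff a b (1 + 3 * k) * (omega * y ^ (1 + 3 * k)) -
        coeff a b (1 + 3 * k) * (omega ^ 2 * y ^ (1 + 3 * k)) =
        coeff a b (1 + 3 * k) * y ^ (1 + 3 * k) * (Real.sqrt 3 * Complex.I) := by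
      rw [← omega_sub_omega_sq]; ring
    rw [e, e', e2]
    push_cast at n1 n2 ⊢
    field_simp
    ring
  · refine s2.neg.congr_fun fun k => ?_
    have n1 : (((2 + 3 * k : ℕ) : ℂ) + 1) ≠ 0 := Nat.cast_add_one_ne_zero _
    have n2 : (((2 + 3 * k : ℕ) : ℂ) + 2) ≠ 0 := by exact_mod_cast Nat.succ_ne_zero (2 + 3 * k + 1)
    have e : (omega ^ 1 * y) ^ (2 + 3 * k) = omega ^ 2 * y ^ (2 + 3 * k) := by
      rw [mul_pow, pow_one, pow_add omega, hw3]; ring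
    have e' : (omega ^ 2 * y) ^ (2 + 3 * k) = omega * y ^ (2 + 3 * k) := by
      rw [mul_pow, ← pow_mul, show 2 * (2 + 3 * k) = 1 + 3 * (1 + 2 * k) by ring, pow_add omega,
        hw3]
      ring
    have e2 : coeff a b (2 + 3 * k) * (omega ^ 2 * y ^ (2 + 3 * k)) -
        coeff a b (2 + 3 * k) * (omega * y ^ (2 + 3 * k)) =
        -(coeff a b (2 + 3 * k) * y ^ (2 + 3 * k) * (Real.sqrt 3 * Complex.I)) := by
      rw [← omega_sub_omega_sq]; ring
    rw [e, e', e2]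
    push_cast at n1 n2 ⊢
    field_simp
    ring
  · intro k
    have e : (omega ^ 1 * y) ^ (3 * k) = (omega ^ 2 * y) ^ (3 * k) := by
      rw [mul_pow, mul_pow, ← pow_mul, ← pow_mul, show 1 * (3 * k) = 3 * k by ring,
        show 2 * (3 * k) = 3 * (2 * k) by ring, hw3, hw3]
    simp only [e, sub_self, mul_zero]

end Identity

/-! ### Extension of the closed form to the cut -/

/-- The half of the sector `|arg y| < π / 3` that lies above (`s > 0`) or below (`s < 0`) the
real axis. -/
def halfSector (s : ℝ) : Set ℂ :=
  {y | 0 < s * y.im ∧ y.im < Real.sqrt 3 * y.re ∧ -y.im < Real.sqrt 3 * y.re}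

theorem isOpen_sector :
    IsOpen {w : ℂ | w.im < Real.sqrt 3 * w.re ∧ -w.im < Real.sqrt 3 * w.re} :=
  (isOpen_lt Complex.continuous_im (continuous_const.mul Complex.continuous_re)).inter
    (isOpen_lt Complex.continuous_im.neg (continuous_const.mul Complex.continuous_re))

theorem isOpen_halfSector (s : ℝ) : IsOpen (halfSector s) :=
  (isOpen_lt continuous_const (continuous_const.mul Complex.continuous_im)).inter isOpen_sector

theorem convex_halfSector (s : ℝ) : Convex ℝ (halfSector s) := by
  have l1 : IsLinearMap ℝ fun w : ℂ => s * w.im :=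
    ⟨fun x y => by simp [mul_add], fun c x => by simp; ring⟩
  have l2 : IsLinearMap ℝ fun w : ℂ => w.im - Real.sqrt 3 * w.re :=
    ⟨fun x y => by simp; ring, fun c x => by simp; ring⟩
  have l3 : IsLinearMap ℝ fun w : ℂ => -w.im - Real.sqrt 3 * w.re :=
    ⟨fun x y => by simp; ring, fun c x => by simp; ring⟩
  have h : halfSector s = {w : ℂ | 0 < s * w.im} ∩ ({w : ℂ | w.im - Real.sqrt 3 * w.re < 0} ∩
      {w : ℂ | -w.im - Real.sqrt 3 * w.re < 0}) := by
    ext w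
    simp [halfSector]
  rw [h]
  exact (convex_halfSpace_gt l1 0).inter ((convex_halfSpace_lt l2 0).inter
    (convex_halfSpace_lt l3 0))

theorem im_pow_three (y : ℂ) : (y ^ 3).im = y.im * (3 * y.re ^ 2 - y.im ^ 2) := by
  simp [pow_succ]; ring

theorem pow_three_mem_cutPlane {s : ℝ} {y : ℂ} (hy : y ∈ halfSector s) : y ^ 3 ∈ cutPlane := by
  obtain ⟨h1, h2, h3⟩ := hy
  have h : Real.sqrt 3 ^ 2 = 3 := Real.sq_sqrt (by norm_num)
  refine Or.inr ?_
  rw [im_pow_three]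
  refine mul_ne_zero (fun h => by simp [h] at h1) ?_
  nlinarith

theorem im_omega_mul (y : ℂ) : (omega * y).im = (Real.sqrt 3 * y.re - y.im) / 2 := by
  simp [omega]; ring

theorem im_omega_sq_mul (y : ℂ) : (omega ^ 2 * y).im = (-y.im - Real.sqrt 3 * y.re) / 2 := by
  rw [omega_sq]; simp [omega]; ring

theorem omega_mul_mem_cutPlane {y : ℂ} (h : y.im < Real.sqrt 3 * y.re) : omega * y ∈ cutPlane :=
  Or.inr (by rw [im_omega_mul]; linarith)

theorem omega_sq_mul_mem_cutPlane {y : ℂ} (h : -y.im < Real.sqrt 3 * y.re) :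
    omega ^ 2 * y ∈ cutPlane :=
  Or.inr (by rw [im_omega_sq_mul]; linarith)

theorem differentiableOn_jump {f : ℂ → ℂ} (hf : DifferentiableOn ℂ f cutPlane) {U : Set ℂ}
    (h1 : ∀ y ∈ U, omega * y ∈ cutPlane) (h2 : ∀ y ∈ U, omega ^ 2 * y ∈ cutPlane) :
    DifferentiableOn ℂ (jump f) U := by
  refine DifferentiableOn.mul (by fun_prop) (DifferentiableOn.sub ?_ ?_)
  · exact hf.comp (by fun_prop) h1
  · exact hf.comp (by fun_prop) h2

section Numerator

variable {a b : Multiset ℂ}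

/-- The identity theorem on the disc together with a half sector: there y³ avoids the cut because Im
y³ ≠ 0, while ωy and ω²y stay off the real axis on the half sector. -/
theorem numeratorC_eq_jump (hcard : a.card = b.card + 1) (ha : ∀ x ∈ a, 0 < x.re)
    (hb : ∀ x ∈ b, ∀ n : ℕ, x ≠ -(n : ℂ)) {s : ℝ} (hs : s ≠ 0) {y : ℂ} (hy : y ∈ halfSector s) :
    numeratorC a b y = jump (hyp a b) y := by
  have hnorm : ∀ (j : ℕ) (y : ℂ), ‖y‖ < 1 → omega ^ j * y ∈ cutPlane := fun j y hy =>
    mem_cutPlane_of_norm_lt (by rw [norm_mul, norm_pow, norm_omega, one_pow, one_mul]; exact hy)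
  have hpc : IsPreconnected (Metric.ball (0 : ℂ) 1 ∪ halfSector s) := by
    have h3 : 0 < Real.sqrt 3 := Real.sqrt_pos.2 (by norm_num)
    have h13 : 1 < Real.sqrt 3 := by
      rw [Real.lt_sqrt (by norm_num)]; norm_num
    have hp : 0 < 1 + |s| := by positivity
    have hb : |s / (1 + |s|)| < 1 := by
      rw [abs_div, abs_of_pos hp, div_lt_one hp]; linarith
    obtain ⟨hb1, hb2⟩ := abs_lt.1 hb
    -- A common point of the disc and the half sector; |Im v| < 1/2 places it in both.
    set v : ℂ := ⟨1 / 2, s / (1 + |s|) / 2⟩ with hv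
    refine IsPreconnected.union v ?_ ⟨?_, ?_, ?_⟩
      (convex_ball _ _).isPreconnected (convex_halfSector s).isPreconnected
    · rw [Metric.mem_ball, dist_zero_right, ← sq_lt_one_iff₀ (norm_nonneg _), Complex.sq_norm,
        Complex.normSq_apply]
      simp only [hv]
      nlinarith
    · have : s * v.im = s ^ 2 / (1 + |s|) / 2 := by simp only [hv]; ring
      rw [this]
      positivity
    · simp only [hv]; linarith
    · simp only [hv]; linarith
  have hpsi : ∀ m, DifferentiableOn ℂ (psiC a b m) (Metric.ball (0 : ℂ) 1 ∪ halfSector s) := by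
    intro m
    refine DifferentiableOn.mul (by fun_prop) ((differentiableOn_hyp (card_psiUpper hcard m)
      (re_pos_of_mem_psiUpper ha m) (ne_neg_of_mem_psiLower hb m)).comp (by fun_prop) ?_)
    rintro y (hy | hy)
    · refine mem_cutPlane_of_norm_lt ?_
      rw [norm_pow]
      exact pow_lt_one₀ (norm_nonneg _) (by simpa using hy) (by norm_num)
    · exact pow_three_mem_cutPlane hy
  refine eqOn_of_hasSum (Metric.isOpen_ball.union (isOpen_halfSector s)) hpc
    (Or.inl (Metric.mem_ball_self one_pos)) (F := numeratorC a b) (G := jump (hyp a b)) ?_ ?_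
    (fun w hw => numeratorC_eq_jump_of_norm_lt hcard ha hb hw) (Or.inr hy)
  · exact (((hpsi 1).sub ((hpsi 2).const_mul 2)).add ((hpsi 4).const_mul 2)).sub (hpsi 5)
  · refine differentiableOn_jump (differentiableOn_hyp hcard ha hb) ?_ ?_
    · rintro y (hy | hy)
      · simpa using hnorm 1 y (by simpa using hy)
      · exact omega_mul_mem_cutPlane hy.2.1
    · rintro y (hy | hy)
      · exact hnorm 2 y (by simpa using hy)
      · exact omega_sq_mul_mem_cutPlane hy.2.2

/-- The boundary values of F are limits along vertical lines in the variable y³, so the approach in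
y is the principal cube root of such a line. The sign of Im γ follows from Im γ³ = Im γ (3 (Re γ)² -
(Im γ)²), whose second factor is positive in the sector. -/
theorem exists_path (s : ℝ) (hs : s ≠ 0) {y : ℝ} (hy : 0 < y) : ∃ γ : ℝ → ℂ,
    Tendsto γ (𝓝[>] 0) (𝓝 (y : ℂ)) ∧
      (∀ ε, γ ε ^ 3 = ((y ^ 3 : ℝ) : ℂ) + ((s * ε : ℝ) : ℂ) * Complex.I) ∧
      ∀ᶠ ε in 𝓝[>] 0, γ ε ∈ halfSector s := by
  set γ : ℝ → ℂ := fun ε =>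
    (((y ^ 3 : ℝ) : ℂ) + ((s * ε : ℝ) : ℂ) * Complex.I) ^ (((3 : ℕ) : ℂ)⁻¹) with hγ
  have h3 : ∀ ε, γ ε ^ 3 = ((y ^ 3 : ℝ) : ℂ) + ((s * ε : ℝ) : ℂ) * Complex.I := fun ε =>
    Complex.cpow_nat_inv_pow _ (by norm_num)
  have hpath : Tendsto (fun ε : ℝ => ((y ^ 3 : ℝ) : ℂ) + ((s * ε : ℝ) : ℂ) * Complex.I) (𝓝[>] 0)
      (𝓝 ((y ^ 3 : ℝ) : ℂ)) := by
    have : Continuous fun ε : ℝ => ((y ^ 3 : ℝ) : ℂ) + ((s * ε : ℝ) : ℂ) * Complex.I := by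
      fun_prop
    simpa using (this.tendsto 0).mono_left (nhdsWithin_le_nhds (s := Set.Ioi (0 : ℝ)))
  have ht : Tendsto γ (𝓝[>] 0) (𝓝 (y : ℂ)) := by
    have hc : ContinuousAt (fun z : ℂ => z ^ (((3 : ℕ) : ℂ)⁻¹)) ((y ^ 3 : ℝ) : ℂ) :=
      continuousAt_cpow_const (Or.inl (by rw [Complex.ofReal_re]; positivity))
    have hv : ((y ^ 3 : ℝ) : ℂ) ^ (((3 : ℕ) : ℂ)⁻¹) = y := by
      rw [show (((3 : ℕ) : ℂ)⁻¹) = ((((3 : ℕ) : ℝ)⁻¹ : ℝ) : ℂ) by push_cast; rfl,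
        ← Complex.ofReal_cpow (by positivity), Real.pow_rpow_inv_natCast hy.le (by norm_num)]
    have := hc.tendsto.comp hpath
    rwa [hv] at this
  refine ⟨γ, ht, h3, ?_⟩
  have h0 : 0 < Real.sqrt 3 := Real.sqrt_pos.2 (by norm_num)
  have hsq : Real.sqrt 3 ^ 2 = 3 := Real.sq_sqrt (by norm_num)
  have hmem : (y : ℂ) ∈ {w : ℂ | w.im < Real.sqrt 3 * w.re ∧ -w.im < Real.sqrt 3 * w.re} := by
    simp; positivity
  filter_upwards [ht.eventually (isOpen_sector.mem_nhds hmem), self_mem_nhdsWithin] with ε hε hε0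
  have hε0 : 0 < ε := hε0
  obtain ⟨h1, h2⟩ := hε
  refine ⟨?_, h1, h2⟩
  have him : (γ ε).im * (3 * (γ ε).re ^ 2 - (γ ε).im ^ 2) = s * ε := by
    rw [← im_pow_three, h3]; simp [-Complex.ofReal_mul, -Complex.ofReal_pow]
  have hpos : 0 < 3 * (γ ε).re ^ 2 - (γ ε).im ^ 2 := by nlinarith
  have : 0 < s * (γ ε).im * (3 * (γ ε).re ^ 2 - (γ ε).im ^ 2) := by
    rw [mul_assoc, him, ← mul_assoc]
    have := mul_self_pos.2 hs
    positivity
  exact (mul_pos_iff_of_pos_right hpos).1 this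

/-- The boundary values of the four hypergeometric functions combine to the closed form. -/
theorem boundary_numerator (hcard : a.card = b.card + 1) (ha : ∀ x ∈ a, 0 < x.re)
    (hb : ∀ x ∈ b, ∀ n : ℕ, x ≠ -(n : ℂ)) {s : ℝ} (hs : s ≠ 0) {y : ℝ} (hy : 0 < y) {L : ℕ → ℂ}
    (hL : ∀ m ∈ ({1, 2, 4, 5} : Finset ℕ),
      Tendsto (fun ε : ℝ => hyp (psiUpper a m) (psiLower b m)
        (((y ^ 3 : ℝ) : ℂ) + ((s * ε : ℝ) : ℂ) * Complex.I)) (𝓝[>] 0) (𝓝 (L m)))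
    {P : ℕ → ℂ} (hP : ∀ m, P m =
      (y : ℂ) ^ (m + 2) * poch a m / (poch {3} m * poch b m) * L m) :
    P 1 - 2 * P 2 + 2 * P 4 - P 5 = jump (hyp a b) y := by
  obtain ⟨γ, hγ, hγ3, hγs⟩ := exists_path s hs hy
  have hpsi : ∀ m ∈ ({1, 2, 4, 5} : Finset ℕ),
      Tendsto (fun ε => psiC a b m (γ ε)) (𝓝[>] 0) (𝓝 (P m)) := by
    intro m hm
    rw [hP]
    simp only [psiC, hγ3]
    exact (((hγ.pow _).mul_const _).div_const _).mul (hL m hm)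
  have h1 : Tendsto (fun ε => numeratorC a b (γ ε)) (𝓝[>] 0)
      (𝓝 (P 1 - 2 * P 2 + 2 * P 4 - P 5)) :=
    (((hpsi 1 (by simp)).sub ((hpsi 2 (by simp)).const_mul 2)).add
      ((hpsi 4 (by simp)).const_mul 2)).sub (hpsi 5 (by simp))
  have h0 : 0 < Real.sqrt 3 := Real.sqrt_pos.2 (by norm_num)
  have hj : ContinuousAt (jump (hyp a b)) y := by
    refine ((differentiableOn_jump (differentiableOn_hyp hcard ha hb)
      (fun w hw => omega_mul_mem_cutPlane hw.1)
      (fun w hw => omega_sq_mul_mem_cutPlane hw.2)).differentiableAt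
        (isOpen_sector.mem_nhds ?_)).continuousAt
    simp; positivity
  refine tendsto_nhds_unique h1 ((hj.tendsto.comp hγ).congr' ?_)
  filter_upwards [hγs] with ε hε
  exact (numeratorC_eq_jump hcard ha hb hs hε).symm

theorem numerator_eq_jump (hcard : a.card = b.card + 1) (ha : ∀ x ∈ a, 0 < x.re)
    (hb : ∀ x ∈ b, ∀ n : ℕ, x ≠ -(n : ℂ)) (s : Side) {y : ℝ} (hy : 0 < y)
    (hbv : ∀ m ∈ ({1, 2, 4, 5} : Finset ℕ),
      HasBoundaryValues (psiUpper a m) (psiLower b m) (y ^ 3)) :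
    numerator s a b y = jump (hyp a b) y := by
  by_cases h1 : y ^ 3 < 1
  · have hy1 : ‖(y : ℂ)‖ < 1 := by
      rw [Complex.norm_real, Real.norm_of_nonneg hy.le]
      by_contra! h
      exact absurd (one_le_pow₀ h (n := 3)) (not_le.2 h1)
    rw [← numeratorC_eq_jump_of_norm_lt hcard ha hb hy1]
    simp [numerator, numeratorC, psi, psiC, hypOn, h1]
  have habove := boundary_numerator hcard ha hb one_ne_zero hy
    (L := fun m => hypAbove (psiUpper a m) (psiLower b m) (y ^ 3))
    (fun m hm => by
      simp only [one_mul]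
      exact tendsto_nhds_limUnder (hbv m hm).1) (fun m => rfl)
  have hbelow := boundary_numerator hcard ha hb (neg_ne_zero.2 one_ne_zero) hy
    (L := fun m => hypBelow (psiUpper a m) (psiLower b m) (y ^ 3))
    (fun m hm => by
      have := tendsto_nhds_limUnder (hbv m hm).2
      simpa [hypBelow, sub_eq_add_neg] using this) (fun m => rfl)
  cases s with
  | above => simpa [numerator, psi, hypOn, h1] using habove
  | below => simpa [numerator, psi, hypOn, h1] using hbelow
  | mean =>
    simp only [numerator, psi, hypOn, h1, if_false]
    linear_combination (1 / 2) * habove + (1 / 2) * hbelow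

/-! ### Real parameters -/

theorem im_poch_eq_zero (c : Multiset ℂ) (hc : ∀ x ∈ c, x.im = 0) (n : ℕ) : (poch c n).im = 0 := by
  have h1 : ∀ x : ℂ, x.im = 0 → ((ascPochhammer ℂ n).eval x).im = 0 := by
    intro x hx
    induction n with
    | zero => simp
    | succ n ih => rw [ascPochhammer_succ_eval]; simp [hx, ih]
  induction c using Multiset.induction with
  | empty => simp [poch]
  | cons x c ih =>
    rw [poch_cons, Complex.mul_im, ih fun z hz => hc z (Multiset.mem_cons_of_mem hz),
      h1 x (hc x (Multiset.mem_cons_self x c))]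
    simp

/-- Schwarz reflection: the coefficients are real and the cut plane is symmetric, so both sides have
the same power series at 0. -/
theorem hyp_conj (hcard : a.card = b.card + 1) (ha : ∀ x ∈ a, 0 < x.re)
    (hb : ∀ x ∈ b, ∀ n : ℕ, x ≠ -(n : ℂ)) (hra : ∀ x ∈ a, x.im = 0) (hrb : ∀ x ∈ b, x.im = 0)
    {w : ℂ} (hw : w ∈ cutPlane) :
    (starRingEnd ℂ) (hyp a b ((starRingEnd ℂ) w)) = hyp a b w := by
  have hconj : ∀ w ∈ cutPlane, (starRingEnd ℂ) w ∈ cutPlane := by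
    intro w hw
    simpa [cutPlane] using hw
  have hf := differentiableOn_hyp hcard ha hb
  refine eqOn_of_hasSum isOpen_cutPlane isPreconnected_cutPlane (Or.inl (by simp))
    (F := starRingEnd ℂ ∘ hyp a b ∘ starRingEnd ℂ) (G := hyp a b) ?_ hf ?_ hw
  · intro w hw
    have := (hf.differentiableAt (isOpen_cutPlane.mem_nhds (hconj w hw))).conj_conj
    rw [Complex.conj_conj] at this
    exact this.differentiableWithinAt
  · intro w hw
    have hs := (isContinuation_hyp hcard ha hb).2
    have h1 := hs ((starRingEnd ℂ) w) (by simpa using hw)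
    have h2 := Complex.hasSum_conj'.2 h1
    refine HasSum.unique (h2.congr_fun fun n => ?_) (hs w hw)
    have hc : (starRingEnd ℂ) (coeff a b n) = coeff a b n := by
      simp [coeff, Complex.conj_eq_iff_im.2 (im_poch_eq_zero a hra n),
        Complex.conj_eq_iff_im.2 (im_poch_eq_zero b hrb n)]
    simp [hc]

theorem im_jump_eq_zero (hcard : a.card = b.card + 1) (ha : ∀ x ∈ a, 0 < x.re)
    (hb : ∀ x ∈ b, ∀ n : ℕ, x ≠ -(n : ℂ)) (hra : ∀ x ∈ a, x.im = 0) (hrb : ∀ x ∈ b, x.im = 0)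
    {y : ℝ} (hy : 0 < y) : (jump (hyp a b) y).im = 0 := by
  have h0 : 0 < Real.sqrt 3 := Real.sqrt_pos.2 (by norm_num)
  have h := hyp_conj hcard ha hb hra hrb (w := omega * y)
    (omega_mul_mem_cutPlane (by simp; positivity))
  rw [map_mul, ← omega_sq, Complex.conj_ofReal] at h
  have h' : hyp a b (omega ^ 2 * y) = (starRingEnd ℂ) (hyp a b (omega * y)) := by
    rw [← h, Complex.conj_conj]
  have e : jump (hyp a b) y =
      ((y ^ 2 / (3 * Real.sqrt 3) * (2 * (hyp a b (omega * y)).im) : ℝ) : ℂ) := by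
    rw [jump, h', Complex.sub_conj]
    have : (Real.sqrt 3 : ℂ) ≠ 0 := by exact_mod_cast h0.ne'
    push_cast
    field_simp [Complex.I_ne_zero]
  rw [e, Complex.ofReal_im]

end Numerator

/-! ### Cauchy's formula in the sector, in logarithmic coordinates -/

theorem neg_exp_mem_cutPlane {x : ℂ} (h1 : -Real.pi < x.im) (h2 : x.im < Real.pi) :
    -Complex.exp x ∈ cutPlane := by
  by_cases h : x.im = 0
  · left
    rw [Complex.neg_re, Complex.exp_re, h, Real.cos_zero, mul_one]
    linarith [Real.exp_pos x.re]
  · right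
    rw [Complex.neg_im, Complex.exp_im, neg_ne_zero]
    exact mul_ne_zero (Real.exp_pos _).ne' fun h' =>
      h ((Real.sin_eq_zero_iff_of_lt_of_lt h1 h2).1 h')

theorem exp_mem_slitPlane {x : ℂ} (h1 : -Real.pi < x.im) (h2 : x.im < Real.pi) :
    Complex.exp x ∈ Complex.slitPlane := by
  by_cases h : x.im = 0
  · left
    rw [Complex.exp_re, h, Real.cos_zero, mul_one]
    exact Real.exp_pos _
  · right
    rw [Complex.exp_im]
    exact mul_ne_zero (Real.exp_pos _).ne' fun h' =>
      h ((Real.sin_eq_zero_iff_of_lt_of_lt h1 h2).1 h')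

theorem three_mul_im_log {z : ℂ} (harg : |z.arg| < Real.pi / 3) :
    -Real.pi < (3 * Complex.log z).im ∧ (3 * Complex.log z).im < Real.pi := by
  obtain ⟨h1, h2⟩ := abs_lt.1 harg
  have h : (3 * Complex.log z).im = 3 * z.arg := by simp [Complex.log_im]
  rw [h]
  constructor <;> linarith

theorem exp_three_mul_log {z : ℂ} (hz : z ≠ 0) : Complex.exp (3 * Complex.log z) = z ^ 3 := by
  rw [show (3 : ℂ) = ((3 : ℕ) : ℂ) by norm_num, Complex.exp_nat_mul, Complex.exp_log hz]

/-- Since |arg z| < π/3, the cube z³ lies in the slit plane, and adding y³ ≥ 0 keeps it there. -/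
theorem pow_three_add_ne_zero {z : ℂ} (hz : z ≠ 0) (harg : |z.arg| < Real.pi / 3) {y : ℝ}
    (hy : 0 ≤ y) : z ^ 3 + (y : ℂ) ^ 3 ≠ 0 := by
  obtain ⟨h1, h2⟩ := three_mul_im_log harg
  have h := exp_mem_slitPlane h1 h2
  rw [exp_three_mul_log hz] at h
  refine Complex.slitPlane_ne_zero ?_
  rw [← Complex.ofReal_pow]
  rcases h with h | h
  · left
    rw [Complex.add_re, Complex.ofReal_re]
    positivity
  · right
    simpa [-Complex.ofReal_pow] using h

section Cauchy

variable {f : ℂ → ℂ} {δ C : ℝ} {z : ℂ}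

theorem continuousOn_jump_div (hf : DifferentiableOn ℂ f cutPlane) (hz : z ≠ 0)
    (harg : |z.arg| < Real.pi / 3) :
    ContinuousOn (fun y : ℝ => jump f y / (z ^ 3 + (y : ℂ) ^ 3)) (Set.Ici 0) := by
  have h0 : 0 < Real.sqrt 3 := Real.sqrt_pos.2 (by norm_num)
  have hm : ∀ y : ℝ, y ∈ Set.Ici (0 : ℝ) → omega * (y : ℂ) ∈ cutPlane := by
    intro y hy
    left
    simp only [omega, Complex.mul_re, Complex.ofReal_re, Complex.ofReal_im]
    have : 0 ≤ y := hy
    linarith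
  have hm2 : ∀ y : ℝ, y ∈ Set.Ici (0 : ℝ) → omega ^ 2 * (y : ℂ) ∈ cutPlane := by
    intro y hy
    left
    rw [omega_sq]
    simp only [omega, Complex.mul_re, Complex.ofReal_re, Complex.ofReal_im, Complex.conj_re]
    have : 0 ≤ y := hy
    linarith
  refine ContinuousOn.div ?_ (by fun_prop) fun y hy => pow_three_add_ne_zero hz harg hy
  refine ContinuousOn.mul (by fun_prop) (ContinuousOn.sub ?_ ?_)
  · exact hf.continuousOn.comp (by fun_prop) hm
  · exact hf.continuousOn.comp (by fun_prop) hm2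

theorem norm_jump_le (hC : ∀ w : ℂ, w.re ≤ 0 → w ≠ 0 → ‖f w‖ ≤ C * ‖w‖ ^ (-δ)) {y : ℝ}
    (hy : 0 < y) : ‖jump f y‖ ≤ y ^ 2 * (C * y ^ (-δ)) := by
  have hy' : (y : ℂ) ≠ 0 := by exact_mod_cast hy.ne'
  have hw : omega ≠ 0 := fun h => by simpa [h] using norm_omega
  have hn : ∀ j : ℕ, ‖omega ^ j * (y : ℂ)‖ = y := fun j => by
    rw [norm_mul, norm_pow, norm_omega, one_pow, one_mul, Complex.norm_real,
      Real.norm_of_nonneg hy.le]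
  have b1 := hC (omega ^ 1 * y) (by simp [omega]; linarith)
    (mul_ne_zero (pow_ne_zero _ hw) hy')
  have b2 := hC (omega ^ 2 * y) (by rw [omega_sq]; simp [omega]; linarith)
    (mul_ne_zero (pow_ne_zero _ hw) hy')
  rw [hn] at b1 b2
  rw [pow_one] at b1
  have h1 : 1 ≤ Real.sqrt 3 := Real.one_le_sqrt.2 (by norm_num)
  have hfac : ‖(y : ℂ) ^ 2 / (3 * (Real.sqrt 3 * Complex.I))‖ ≤ y ^ 2 / 2 := by
    rw [norm_div, norm_pow, Complex.norm_real, Real.norm_of_nonneg hy.le, norm_mul, norm_mul,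
      Complex.norm_I, mul_one, Complex.norm_real, Real.norm_of_nonneg (by positivity)]
    refine div_le_div_of_nonneg_left (by positivity) (by norm_num) ?_
    simp
    linarith
  rw [jump, norm_mul]
  calc _ ≤ y ^ 2 / 2 * (C * y ^ (-δ) + C * y ^ (-δ)) :=
        mul_le_mul hfac ((norm_sub_le _ _).trans (add_le_add b1 b2)) (norm_nonneg _)
          (by positivity)
    _ = _ := by ring

theorem integrableOn_jump_div (hf : DifferentiableOn ℂ f cutPlane) (hδ : 0 < δ)
    (hC : ∀ w : ℂ, w.re ≤ 0 → w ≠ 0 → ‖f w‖ ≤ C * ‖w‖ ^ (-δ)) (hz : z ≠ 0)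
    (harg : |z.arg| < Real.pi / 3) :
    IntegrableOn (fun y : ℝ => jump f y / (z ^ 3 + (y : ℂ) ^ 3)) (Set.Ioi 0) := by
  have hc := continuousOn_jump_div hf hz harg
  -- Beyond B one has |z|³ ≤ y³/8, so |z³ + y³| ≥ y³/2 and the integrand is at most 2C y^{-1-δ}.
  set B : ℝ := 2 * ‖z‖ + 1
  have hB : 0 < B := by positivity
  rw [← Set.Ioc_union_Ioi_eq_Ioi hB.le]
  refine IntegrableOn.union ?_ ?_
  · exact ((hc.mono Set.Icc_subset_Ici_self).integrableOn_Icc).mono_set Set.Ioc_subset_Icc_self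
  · have hi := (integrableOn_Ioi_rpow_of_lt (a := -1 - δ) (by linarith) hB).const_mul (2 * C)
    refine Integrable.mono' hi ((hc.mono fun y hy => (hB.trans hy).le).aestronglyMeasurable
      measurableSet_Ioi) ((ae_restrict_iff' measurableSet_Ioi).2 (Eventually.of_forall ?_))
    intro y hy
    have hyB : B < y := hy
    have hy0 : 0 < y := hB.trans hyB
    have hden : y ^ 3 / 2 ≤ ‖z ^ 3 + (y : ℂ) ^ 3‖ := by
      have h1 : ‖(y : ℂ) ^ 3‖ - ‖z ^ 3‖ ≤ ‖z ^ 3 + (y : ℂ) ^ 3‖ := by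
        have := norm_sub_norm_le ((y : ℂ) ^ 3) (-z ^ 3)
        rw [sub_neg_eq_add, norm_neg, add_comm] at this
        exact this
      rw [norm_pow, norm_pow, Complex.norm_real, Real.norm_of_nonneg hy0.le] at h1
      have h2 : (2 * ‖z‖) ^ 3 ≤ y ^ 3 := by
        refine pow_le_pow_left₀ (by positivity) ?_ 3
        linarith
      have h3 : 0 ≤ ‖z‖ ^ 3 := by positivity
      nlinarith
    have hj := norm_jump_le hC hy0
    have hp : y ^ (-1 - δ) = y ^ (-δ) / y := by
      rw [show -1 - δ = -δ - 1 by ring, Real.rpow_sub_one hy0.ne']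
    rw [norm_div, hp]
    calc _ ≤ y ^ 2 * (C * y ^ (-δ)) / (y ^ 3 / 2) :=
          div_le_div₀ ((norm_nonneg _).trans hj) hj (by positivity) hden
      _ = _ := by field_simp

theorem norm_comp_neg_exp_le (hC : ∀ w : ℂ, w.re ≤ 0 → w ≠ 0 → ‖f w‖ ≤ C * ‖w‖ ^ (-δ)) {x : ℂ}
    (h1 : -(Real.pi / 2) ≤ x.im) (h2 : x.im ≤ Real.pi / 2) :
    ‖f (-Complex.exp x)‖ ≤ C * Real.exp (-δ * x.re) := by
  refine (hC _ ?_ (neg_ne_zero.2 (Complex.exp_ne_zero _))).trans_eq ?_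
  · rw [Complex.neg_re, Complex.exp_re, neg_nonpos]
    exact mul_nonneg (Real.exp_pos _).le (Real.cos_nonneg_of_neg_pi_div_two_le_of_le h1 h2)
  · rw [norm_neg, Complex.norm_exp, ← Real.exp_mul, mul_comm x.re]

/-- The kernel `3 e^{3x} / (e^{3x} - e^{3ζ})` times `g(x) - g(ζ)`, with its removable singularity
filled in. -/
def sectorKernel (f : ℂ → ℂ) (ζ x : ℂ) : ℂ :=
  3 * Complex.exp (3 * x) * dslope (fun x => f (-Complex.exp x)) ζ x /
    dslope (fun x => Complex.exp (3 * x) - Complex.exp (3 * ζ)) ζ x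

theorem sectorKernel_of_ne {ζ x : ℂ} (h : x ≠ ζ) : sectorKernel f ζ x =
    3 * Complex.exp (3 * x) * (f (-Complex.exp x) - f (-Complex.exp ζ)) /
      (Complex.exp (3 * x) - Complex.exp (3 * ζ)) := by
  have h' : x - ζ ≠ 0 := sub_ne_zero.2 h
  rw [sectorKernel, dslope_of_ne _ h, dslope_of_ne _ h, slope_def_field, slope_def_field,
    sub_self, sub_zero]
  field_simp

theorem exp_three_mul_ne {ζ x : ℂ} (h : x ≠ ζ) (h1 : |x.im - ζ.im| < 2 * Real.pi / 3) :
    Complex.exp (3 * x) ≠ Complex.exp (3 * ζ) := by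
  intro he
  obtain ⟨n, hn⟩ := Complex.exp_eq_exp_iff_exists_int.1 he
  have him := congrArg Complex.im hn
  simp at him
  have hn0 : n = 0 := by
    by_contra hn0
    have : (1 : ℝ) ≤ |(n : ℝ)| := by exact_mod_cast Int.one_le_abs hn0
    have h2 : x.im - ζ.im = n * (2 * Real.pi) / 3 := by linarith
    rw [h2, abs_div, abs_mul, abs_of_pos Real.two_pi_pos, abs_of_pos (by norm_num : (0 : ℝ) < 3)]
      at h1
    nlinarith [Real.pi_pos]
  subst hn0
  apply h
  simpa using hn

/-- Both factors of x - ζ are removed by `dslope`. The remaining denominator is 3e^{3ζ} at ζ and has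
no zero elsewhere: another zero would differ from ζ by a nonzero multiple of 2πi/3, too far for the
strip. -/
theorem differentiableOn_sectorKernel (hf : DifferentiableOn ℂ f cutPlane) {ζ : ℂ}
    (hζ : |ζ.im| < Real.pi / 3) :
    DifferentiableOn ℂ (sectorKernel f ζ) {x | |x.im| ≤ Real.pi / 3} := by
  have hpi := Real.pi_pos
  have hTo : IsOpen {x : ℂ | |x.im| < Real.pi} :=
    isOpen_lt Complex.continuous_im.abs continuous_const
  have hζT : {x : ℂ | |x.im| < Real.pi} ∈ 𝓝 ζ := hTo.mem_nhds (by
    simp only [Set.mem_ofPred_eq]; linarith)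
  have hg : DifferentiableOn ℂ (fun x => f (-Complex.exp x)) {x : ℂ | |x.im| < Real.pi} :=
    hf.comp (by fun_prop) fun x hx => neg_exp_mem_cutPlane (abs_lt.1 hx).1 (abs_lt.1 hx).2
  have hsub : {x : ℂ | |x.im| ≤ Real.pi / 3} ⊆ {x : ℂ | |x.im| < Real.pi} := fun x hx => by
    simp only [Set.mem_ofPred_eq] at hx ⊢; linarith
  have hd1 := ((Complex.differentiableOn_dslope hζT).2 hg).mono hsub
  have hE : Differentiable ℂ fun x => Complex.exp (3 * x) - Complex.exp (3 * ζ) := by fun_prop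
  have hd2 := ((Complex.differentiableOn_dslope (univ_mem : Set.univ ∈ 𝓝 ζ)).2
    hE.differentiableOn).mono (Set.subset_univ {x : ℂ | |x.im| ≤ Real.pi / 3})
  refine DifferentiableOn.div (DifferentiableOn.mul (by fun_prop) hd1) hd2 fun x hx => ?_
  by_cases h : x = ζ
  · subst h
    have : HasDerivAt (fun y => Complex.exp (3 * y) - Complex.exp (3 * x))
        (Complex.exp (3 * x) * 3) x := by
      simpa using (((hasDerivAt_id x).const_mul 3).cexp).sub_const (Complex.exp (3 * x))
    rw [dslope_same, this.deriv]
    exact mul_ne_zero (Complex.exp_ne_zero _) (by norm_num)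
  · rw [dslope_of_ne _ h, slope_def_field, sub_self, sub_zero]
    refine div_ne_zero (sub_ne_zero.2 (exp_three_mul_ne h ?_)) (sub_ne_zero.2 h)
    refine (abs_sub _ _).trans_lt ?_
    have : |x.im| ≤ Real.pi / 3 := hx
    linarith

theorem exp_three_mul_edge (s : ℝ) {θ : ℝ} (hθ : θ = Real.pi / 3 ∨ θ = -(Real.pi / 3)) :
    Complex.exp (3 * (s + θ * Complex.I)) = -(Real.exp s : ℂ) ^ 3 := by
  rw [mul_add, Complex.exp_add, Complex.ofReal_exp, ← Complex.exp_nat_mul]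
  rcases hθ with rfl | rfl
  · rw [show (3 : ℂ) * (((Real.pi / 3 : ℝ) : ℂ) * Complex.I) = Real.pi * Complex.I by
      push_cast; ring, Complex.exp_pi_mul_I]
    push_cast; ring
  · rw [show (3 : ℂ) * (((-(Real.pi / 3) : ℝ) : ℂ) * Complex.I) = -(Real.pi * Complex.I) by
      push_cast; ring, Complex.exp_neg, Complex.exp_pi_mul_I]
    push_cast; ring

theorem neg_exp_edge_below (s : ℝ) :
    -Complex.exp (s + (-(Real.pi / 3) : ℝ) * Complex.I) = omega * (Real.exp s : ℂ) := by
  apply Complex.ext <;> simp [Complex.exp_re, Complex.exp_im, omega] <;> ring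

theorem neg_exp_edge_above (s : ℝ) :
    -Complex.exp (s + (Real.pi / 3 : ℝ) * Complex.I) = omega ^ 2 * (Real.exp s : ℂ) := by
  rw [omega_sq]
  apply Complex.ext <;> simp [Complex.exp_re, Complex.exp_im, omega] <;> ring

/-- The difference of the integrands on the horizontal edges. -/
theorem sectorKernel_edge_sub (hz : z ≠ 0) (harg : |z.arg| < Real.pi / 3) (s : ℝ) :
    sectorKernel f (Complex.log z) (s + (-(Real.pi / 3) : ℝ) * Complex.I) -
      sectorKernel f (Complex.log z) (s + (Real.pi / 3 : ℝ) * Complex.I) =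
    9 * (Real.sqrt 3 * Complex.I) * (Real.exp s • (jump f (Real.exp s : ℝ) /
      (z ^ 3 + ((Real.exp s : ℝ) : ℂ) ^ 3))) := by
  obtain ⟨ha1, ha2⟩ := abs_lt.1 harg
  have n1 : (s + (-(Real.pi / 3) : ℝ) * Complex.I : ℂ) ≠ Complex.log z := fun h => by
    have := congrArg Complex.im h
    rw [Complex.log_im] at this
    simp [-Complex.ofReal_neg, -Complex.ofReal_div] at this
    linarith
  have n2 : (s + (Real.pi / 3 : ℝ) * Complex.I : ℂ) ≠ Complex.log z := fun h => by
    have := congrArg Complex.im h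
    rw [Complex.log_im] at this
    simp [-Complex.ofReal_neg, -Complex.ofReal_div] at this
    linarith
  rw [sectorKernel_of_ne n1, sectorKernel_of_ne n2, exp_three_mul_edge s (Or.inr rfl),
    exp_three_mul_edge s (Or.inl rfl), neg_exp_edge_below, neg_exp_edge_above,
    exp_three_mul_log hz, Complex.real_smul, jump]
  have hd := pow_three_add_ne_zero hz harg (Real.exp_pos s).le
  have hd' : -(Real.exp s : ℂ) ^ 3 - z ^ 3 ≠ 0 := fun h => hd (by linear_combination -h)
  have hI := sqrt_three_mul_I_ne_zero
  generalize (Real.sqrt 3 : ℂ) * Complex.I = c at *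
  generalize ((Real.exp s : ℝ) : ℂ) = y at *
  rw [show -y ^ 3 - z ^ 3 = -(z ^ 3 + y ^ 3) by ring]
  field_simp
  ring

end Cauchy

section Limits

variable {f : ℂ → ℂ} {δ C : ℝ} {z : ℂ}

theorem norm_exp_three_mul (x : ℂ) : ‖Complex.exp (3 * x)‖ = Real.exp (3 * x.re) := by
  rw [Complex.norm_exp]; simp

/-- As Re x → ∞ the factor 3e^{3x}/(e^{3x} - z³) tends to 3 and f(-e^x) to 0, so the subtracted
constant survives as -3f(-z). It plays the part of the residue in the contour integral. -/
theorem sectorKernel_right_le (hδ1 : δ ≤ 1)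
    (hC : ∀ w : ℂ, w.re ≤ 0 → w ≠ 0 → ‖f w‖ ≤ C * ‖w‖ ^ (-δ)) (hz : z ≠ 0) :
    ∃ M : ℝ, ∀ᶠ R : ℝ in atTop, ∀ θ : ℝ, |θ| ≤ Real.pi / 3 →
      ‖sectorKernel f (Complex.log z) (R + θ * Complex.I) + 3 * f (-z)‖ ≤
        M * Real.exp (-δ * R) := by
  refine ⟨6 * C + 6 * ‖f (-z)‖ * ‖z‖ ^ 3, ?_⟩
  filter_upwards [eventually_gt_atTop 0, eventually_gt_atTop (Complex.log z).re,
    (Real.tendsto_exp_atTop.comp (tendsto_id.const_mul_atTop (zero_lt_three' ℝ))).eventually_ge_atTop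
      (2 * ‖z‖ ^ 3)] with R hR0 hR1 hR2 θ hθ
  obtain ⟨t1, t2⟩ := abs_le.1 hθ
  have hpi := Real.pi_pos
  simp only [Function.comp, id] at hR2
  set x : ℂ := R + θ * Complex.I with hx
  have hre : x.re = R := by simp [hx]
  have him : x.im = θ := by simp [hx]
  have hne : x ≠ Complex.log z := fun h => by rw [← h, hre] at hR1; exact hR1.false
  have hg := norm_comp_neg_exp_le hC (x := x) (by rw [him]; linarith) (by rw [him]; linarith)
  rw [hre] at hg
  have hE : ‖Complex.exp (3 * x)‖ = Real.exp (3 * R) := by rw [norm_exp_three_mul, hre]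
  have hden : Real.exp (3 * R) / 2 ≤ ‖Complex.exp (3 * x) - z ^ 3‖ := by
    have := norm_sub_norm_le (Complex.exp (3 * x)) (z ^ 3)
    rw [hE, norm_pow] at this
    linarith
  have hpos := Real.exp_pos (3 * R)
  have hden0 : Complex.exp (3 * x) - z ^ 3 ≠ 0 := norm_pos_iff.1 (by linarith)
  rw [sectorKernel_of_ne hne, exp_three_mul_log hz, Complex.exp_log hz]
  have e : 3 * Complex.exp (3 * x) * (f (-Complex.exp x) - f (-z)) / (Complex.exp (3 * x) - z ^ 3) +
      3 * f (-z) = (3 * Complex.exp (3 * x) * f (-Complex.exp x) - 3 * f (-z) * z ^ 3) /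
        (Complex.exp (3 * x) - z ^ 3) := by
    field_simp
    ring
  have hnum : ‖3 * Complex.exp (3 * x) * f (-Complex.exp x) - 3 * f (-z) * z ^ 3‖ ≤
      3 * Real.exp (3 * R) * (C * Real.exp (-δ * R)) + 3 * ‖f (-z)‖ * ‖z‖ ^ 3 := by
    refine (norm_sub_le _ _).trans (add_le_add ?_ ?_)
    · rw [norm_mul, norm_mul, hE]
      simp only [Complex.norm_ofNat]
      gcongr
    · rw [norm_mul, norm_mul, norm_pow]
      simp
  have hexp : 1 ≤ Real.exp (3 * R) * Real.exp (-δ * R) := by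
    rw [← Real.exp_add, Real.one_le_exp_iff]
    nlinarith
  rw [e, norm_div]
  refine (div_le_div₀ ((norm_nonneg _).trans hnum) hnum (by positivity) hden).trans ?_
  rw [div_le_iff₀ (by positivity)]
  have h0 : 0 ≤ 3 * ‖f (-z)‖ * ‖z‖ ^ 3 := by positivity
  nlinarith

/-- Near w = 0 the bound on f only allows growth e^{δR}, which the factor e^{3x}, of size e^{-3R},
outweighs because δ ≤ 1. -/
theorem sectorKernel_left_le (hδ1 : δ ≤ 1)
    (hC : ∀ w : ℂ, w.re ≤ 0 → w ≠ 0 → ‖f w‖ ≤ C * ‖w‖ ^ (-δ)) (hz : z ≠ 0) :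
    ∃ M : ℝ, ∀ᶠ R : ℝ in atTop, ∀ θ : ℝ, |θ| ≤ Real.pi / 3 →
      ‖sectorKernel f (Complex.log z) (-R + θ * Complex.I)‖ ≤ M * Real.exp (-δ * R) := by
  have hC0 : 0 ≤ C := by
    have := hC (-1) (by simp) (by simp)
    simp at this
    exact (norm_nonneg _).trans this
  have hzn : 0 < ‖z‖ ^ 3 := pow_pos (norm_pos_iff.2 hz) 3
  refine ⟨6 * (C + ‖f (-z)‖) / ‖z‖ ^ 3, ?_⟩
  have hlim : Tendsto (fun R : ℝ => Real.exp (-(3 * R))) atTop (𝓝 0) :=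
    Real.tendsto_exp_neg_atTop_nhds_zero.comp (tendsto_id.const_mul_atTop (zero_lt_three' ℝ))
  filter_upwards [eventually_gt_atTop 0, eventually_gt_atTop (-(Complex.log z).re),
    hlim.eventually (gt_mem_nhds (half_pos hzn))] with R hR0 hR1 hR2 θ hθ
  obtain ⟨t1, t2⟩ := abs_le.1 hθ
  have hpi := Real.pi_pos
  set x : ℂ := -R + θ * Complex.I with hx
  have hre : x.re = -R := by simp [hx]
  have him : x.im = θ := by simp [hx]
  have hne : x ≠ Complex.log z := fun h => by rw [← h, hre] at hR1; simp at hR1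
  have hg := norm_comp_neg_exp_le hC (x := x) (by rw [him]; linarith) (by rw [him]; linarith)
  rw [hre] at hg
  have hE : ‖Complex.exp (3 * x)‖ = Real.exp (-(3 * R)) := by
    rw [norm_exp_three_mul, hre, mul_neg]
  have hden : ‖z‖ ^ 3 / 2 ≤ ‖Complex.exp (3 * x) - z ^ 3‖ := by
    have := norm_sub_norm_le (z ^ 3) (Complex.exp (3 * x))
    rw [hE, norm_pow, norm_sub_rev] at this
    linarith
  rw [sectorKernel_of_ne hne, exp_three_mul_log hz, Complex.exp_log hz, norm_div]
  have hnum : ‖3 * Complex.exp (3 * x) * (f (-Complex.exp x) - f (-z))‖ ≤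
      3 * Real.exp (-(3 * R)) * (C * Real.exp (-δ * -R) + ‖f (-z)‖) := by
    rw [norm_mul, norm_mul, hE]
    simp only [Complex.norm_ofNat]
    gcongr
    exact (norm_sub_le _ _).trans (add_le_add hg le_rfl)
  refine (div_le_div₀ ((norm_nonneg _).trans hnum) hnum (by positivity) hden).trans ?_
  have h1 : Real.exp (-(3 * R)) * Real.exp (-δ * -R) ≤ Real.exp (-δ * R) := by
    rw [← Real.exp_add]
    exact Real.exp_le_exp.2 (by nlinarith)
  have h2 : Real.exp (-(3 * R)) ≤ Real.exp (-δ * R) := Real.exp_le_exp.2 (by nlinarith)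
  have h3 : 3 * Real.exp (-(3 * R)) * (C * Real.exp (-δ * -R) + ‖f (-z)‖) ≤
      3 * (C + ‖f (-z)‖) * Real.exp (-δ * R) := by
    have := mul_le_mul_of_nonneg_left h1 hC0
    have := mul_le_mul_of_nonneg_left h2 (norm_nonneg (f (-z)))
    nlinarith
  refine (div_le_div_of_nonneg_right h3 (by positivity)).trans_eq ?_
  field_simp
  ring

theorem tendsto_integral_exp {Φ : ℝ → ℂ} (hΦ : IntegrableOn Φ (Set.Ioi 0))
    (hc : ContinuousOn Φ (Set.Ici 0)) :
    Tendsto (fun R : ℝ => ∫ s in (-R)..R, Real.exp s • Φ (Real.exp s)) atTop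
      (𝓝 (∫ y in Set.Ioi (0 : ℝ), Φ y)) := by
  have h1 : ∀ R : ℝ, ∫ s in (-R)..R, Real.exp s • Φ (Real.exp s) =
      ∫ y in Real.exp (-R)..Real.exp R, Φ y := fun R =>
    intervalIntegral.integral_deriv_smul_comp'' Real.continuous_exp.continuousOn
      (fun x _ => (Real.hasDerivAt_exp x).hasDerivWithinAt) Real.continuous_exp.continuousOn
      (hc.mono (by rintro _ ⟨s, -, rfl⟩; exact (Real.exp_pos s).le))
  have hcov : AECover (volume.restrict (Set.Ioi (0 : ℝ))) atTop
      fun R : ℝ => Set.Ioi (Real.exp (-R)) ∩ Set.Iic (Real.exp R) :=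
    (aecover_Ioi_of_Ioi Real.tendsto_exp_neg_atTop_nhds_zero).inter
      (aecover_Iic Real.tendsto_exp_atTop).restrict
  refine (hcov.integral_tendsto_of_countably_generated hΦ).congr' ?_
  filter_upwards [eventually_ge_atTop 0] with R hR
  rw [h1, intervalIntegral.integral_of_le (Real.exp_le_exp.2 (by linarith)), Set.Ioi_inter_Iic,
    Measure.restrict_restrict measurableSet_Ioc, Set.inter_eq_left.2]
  exact fun y hy => (Real.exp_pos _).trans hy.1

/-- Cauchy's formula for the sector `|arg (-w)| < π / 3`. -/
theorem integral_jump_div (hf : DifferentiableOn ℂ f cutPlane) (hδ : 0 < δ) (hδ1 : δ ≤ 1)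
    (hC : ∀ w : ℂ, w.re ≤ 0 → w ≠ 0 → ‖f w‖ ≤ C * ‖w‖ ^ (-δ)) (hz : z ≠ 0)
    (harg : |z.arg| < Real.pi / 3) :
    9 * (Real.sqrt 3 * Complex.I) * ∫ y in Set.Ioi (0 : ℝ), jump f y / (z ^ 3 + (y : ℂ) ^ 3) =
      2 * Real.pi * Complex.I * f (-z) := by
  have hpi := Real.pi_pos
  set ζ := Complex.log z
  have hζ : |ζ.im| < Real.pi / 3 := by rwa [Complex.log_im]
  have hH := differentiableOn_sectorKernel hf hζ
  set H := sectorKernel f ζ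
  have hle : -(Real.pi / 3) ≤ Real.pi / 3 := by linarith
  have hrect : ∀ R : ℝ, 9 * (Real.sqrt 3 * Complex.I) *
      (∫ s in (-R)..R, Real.exp s • (jump f (Real.exp s : ℝ) /
        (z ^ 3 + ((Real.exp s : ℝ) : ℂ) ^ 3))) =
      Complex.I * (∫ θ in (-(Real.pi / 3))..(Real.pi / 3), H ((-R : ℝ) + θ * Complex.I)) -
      Complex.I * ∫ θ in (-(Real.pi / 3))..(Real.pi / 3), H (R + θ * Complex.I) := by
    intro R
    -- On the horizontal edges the f(-z) terms cancel, leaving the jump integral after the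
    -- substitution y = e^s.
    have h := Complex.integral_boundary_rect_eq_zero_of_differentiableOn H
      ⟨-R, -(Real.pi / 3)⟩ ⟨R, Real.pi / 3⟩ (hH.mono fun x hx => by
        have := hx.2
        simp only [Set.mem_preimage, Set.uIcc_of_le hle] at this
        exact abs_le.2 this)
    have hedge : ∀ θ : ℝ, |θ| ≤ Real.pi / 3 →
        IntervalIntegrable (fun s : ℝ => H (s + θ * Complex.I)) volume (-R) R := by
      intro θ hθ
      refine Continuous.intervalIntegrable ?_ _ _
      refine hH.continuousOn.comp_continuous (by fun_prop) fun s => ?_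
      simpa using hθ
    simp only [smul_eq_mul] at h
    rw [← intervalIntegral.integral_sub (hedge _ (by rw [abs_neg, abs_of_pos (by positivity)]))
      (hedge _ (by rw [abs_of_pos (by positivity)]))] at h
    simp only [H, ζ, sectorKernel_edge_sub hz harg] at h
    rw [intervalIntegral.integral_const_mul] at h
    simp only [H, ζ]
    linear_combination h
  have hexp : Tendsto (fun R : ℝ => Real.exp (-δ * R)) atTop (𝓝 0) := by
    have := Real.tendsto_exp_neg_atTop_nhds_zero.comp (tendsto_id.const_mul_atTop hδ)
    simpa [Function.comp_def] using this
  have hθ : ∀ θ ∈ Set.uIoc (-(Real.pi / 3)) (Real.pi / 3), |θ| ≤ Real.pi / 3 := by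
    intro θ hθ
    rw [Set.uIoc_of_le hle] at hθ
    exact abs_le.2 ⟨hθ.1.le, hθ.2⟩
  have hleft : Tendsto (fun R : ℝ => ∫ θ in (-(Real.pi / 3))..(Real.pi / 3),
      H ((-R : ℝ) + θ * Complex.I)) atTop (𝓝 0) := by
    obtain ⟨M, hM⟩ := sectorKernel_left_le hδ1 hC hz
    refine squeeze_zero_norm' (a := fun R => M * Real.exp (-δ * R) *
      |Real.pi / 3 - -(Real.pi / 3)|) ?_ (by simpa using (hexp.const_mul M).mul_const _)
    filter_upwards [hM] with R hR
    refine intervalIntegral.norm_integral_le_of_norm_le_const fun θ h => ?_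
    rw [Complex.ofReal_neg]
    exact hR θ (hθ θ h)
  -- The limit is -3f(-z) times the height 2π/3 of the rectangle.
  have hright : Tendsto (fun R : ℝ => ∫ θ in (-(Real.pi / 3))..(Real.pi / 3),
      H (R + θ * Complex.I)) atTop (𝓝 (-(2 * Real.pi * f (-z)))) := by
    obtain ⟨M, hM⟩ := sectorKernel_right_le hδ1 hC hz
    rw [tendsto_iff_norm_sub_tendsto_zero]
    refine squeeze_zero' (g := fun R => M * Real.exp (-δ * R) * |Real.pi / 3 - -(Real.pi / 3)|)
      (Eventually.of_forall fun R => norm_nonneg _) ?_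
      (by simpa using (hexp.const_mul M).mul_const _)
    filter_upwards [hM] with R hR
    have hi : IntervalIntegrable (fun θ : ℝ => H (R + θ * Complex.I)) volume
        (-(Real.pi / 3)) (Real.pi / 3) := by
      refine ContinuousOn.intervalIntegrable ?_
      refine hH.continuousOn.comp (by fun_prop) fun θ h => ?_
      rw [Set.uIcc_of_le hle] at h
      simpa using abs_le.2 h
    have e : (∫ θ in (-(Real.pi / 3))..(Real.pi / 3), H (R + θ * Complex.I)) -
        -(2 * Real.pi * f (-z)) =
        ∫ θ in (-(Real.pi / 3))..(Real.pi / 3), (H (R + θ * Complex.I) + 3 * f (-z)) := by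
      rw [intervalIntegral.integral_add hi (by simp), intervalIntegral.integral_const,
        Complex.real_smul]
      push_cast
      ring
    rw [e]
    exact intervalIntegral.norm_integral_le_of_norm_le_const fun θ h => hR θ (hθ θ h)
  have hmain := (tendsto_integral_exp (integrableOn_jump_div hf hδ hC hz harg)
    (continuousOn_jump_div hf hz harg)).const_mul (9 * (Real.sqrt 3 * Complex.I))
  simp only [hrect] at hmain
  have := tendsto_nhds_unique hmain ((hleft.const_mul Complex.I).sub (hright.const_mul Complex.I))
  rw [this]
  ring

end Limits

end GenHyp

end

/-! ### Assembly -/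

theorem mainTheorem4 (p : ℕ) (a b : Multiset ℂ)
    (ha_card : a.card = p + 1) (hb_card : b.card = p)
    (ha : ∀ x ∈ a, 0 < x.re) (hb : ∀ x ∈ b, ∀ n : ℕ, x ≠ -(n : ℂ)) :
    (∀ y : ℝ, 0 < y → y ≠ 1 → ∀ m ∈ ({1, 2, 4, 5} : Finset ℕ),
      GenHyp.HasBoundaryValues (GenHyp.psiUpper a m) (GenHyp.psiLower b m) (y ^ 3)) ∧
    (∀ s : GenHyp.Side, ∀ z : ℂ, z ≠ 0 → |z.arg| < Real.pi / 3 →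
      IntegrableOn (fun y : ℝ => GenHyp.numerator s a b y / (z ^ 3 + (y : ℂ) ^ 3))
        (Set.Ioi 0) ∧
      GenHyp.hyp a b (-z) =
        ((9 * Real.sqrt 3 / (2 * Real.pi) : ℝ) : ℂ) *
          ∫ y in Set.Ioi (0 : ℝ), GenHyp.numerator s a b y / (z ^ 3 + (y : ℂ) ^ 3)) ∧
    ((∀ x ∈ a, x.im = 0) → (∀ x ∈ b, x.im = 0) →
      ∀ s : GenHyp.Side, ∀ y : ℝ, 0 < y →
        (∀ m ∈ ({1, 2, 4, 5} : Finset ℕ),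
          GenHyp.HasBoundaryValues (GenHyp.psiUpper a m) (GenHyp.psiLower b m) (y ^ 3)) →
        (GenHyp.numerator s a b y).im = 0) := by
  have hcard : a.card = b.card + 1 := by omega
  have hbv : ∀ y : ℝ, 0 < y → y ≠ 1 → ∀ m ∈ ({1, 2, 4, 5} : Finset ℕ),
      GenHyp.HasBoundaryValues (GenHyp.psiUpper a m) (GenHyp.psiLower b m) (y ^ 3) :=
    fun y hy hy1 m _ => GenHyp.hasBoundaryValues_of_ne_one (GenHyp.card_psiUpper hcard m)
      (GenHyp.re_pos_of_mem_psiUpper ha m) (GenHyp.ne_neg_of_mem_psiLower hb m)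
      fun h => hy1 ((pow_eq_one_iff_of_nonneg hy.le (by norm_num)).1 h)
  refine ⟨hbv, fun s z hz harg => ?_, fun hra hrb s y hy h => ?_⟩
  · obtain ⟨δ, C, h0, h1, hC⟩ := GenHyp.norm_hyp_le hcard ha hb
    have hf := GenHyp.differentiableOn_hyp hcard ha hb
    -- Only y = 1 can lack boundary values, and a single point does not affect the integral.
    have hae : (fun y : ℝ => GenHyp.jump (GenHyp.hyp a b) y / (z ^ 3 + (y : ℂ) ^ 3))
        =ᵐ[volume.restrict (Set.Ioi 0)]
          fun y : ℝ => GenHyp.numerator s a b y / (z ^ 3 + (y : ℂ) ^ 3) := by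
      filter_upwards [ae_restrict_mem measurableSet_Ioi,
        ae_restrict_of_ae (Measure.ae_ne volume (1 : ℝ))] with y hy hy1
      rw [GenHyp.numerator_eq_jump hcard ha hb s hy (hbv y hy hy1)]
    refine ⟨(GenHyp.integrableOn_jump_div hf h0 hC hz harg).congr hae, ?_⟩
    rw [← integral_congr_ae hae]
    have key := GenHyp.integral_jump_div hf h0 h1 hC hz harg
    have hpi : (Real.pi : ℂ) ≠ 0 := by exact_mod_cast Real.pi_ne_zero
    push_cast
    rw [div_mul_eq_mul_div, eq_div_iff (mul_ne_zero two_ne_zero hpi)]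
    refine mul_right_cancel₀ Complex.I_ne_zero ?_
    linear_combination -key
  · rw [GenHyp.numerator_eq_jump hcard ha hb s hy h]
    exact GenHyp.im_jump_eq_zero hcard ha hb hra hrb hy
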